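/- Let $M$ and $N$ be smooth finite-dimensional manifolds (without boundary), let $\langle\cdot,\cdot\rangle$ be a smooth Riemannian metric on $M$ with Levi-Civita connection $\nabla$, and let $\varphi:M\to N$ be a submersion, i.e. a smooth surjective map whose differential is surjective at every point. Let $\pi:TM\to M$ be the tangent bundle and $K:T_\xi TM\to T_{\pi(\xi)}M$ the connection map of $\nabla$, so that $K(Y_*v)=\nabla_vY$ for vector fields $Y$ on $M$. For $\xi,X\in T_xM$ let $X^h_\xi\in T_\xi TM$ be the unique vector with $\pi_*X^h_\xi=X$, $KX^h_\xi=0$, and $X^v_\xi\in T_\xi TM$ the unique vector with $\pi_*X^v_\xi=0$, $KX^v_\xi=X$. Put $\omega_a(\xi)=(1+a\langle\xi,\xi\rangle)^{-1}$. Let $p,q,\alpha\in\mathbb R$ with $q\ge 0$, $\alpha>0$, and equip $TM$ with the Cheeger–Gromoll type metric $$h_{p,q,\alpha}(A,B)=\langle\pi_*A,\pi_*B\rangle+\omega_\alpha(\xi)^p\big(\langle KA,KB\rangle+q\langle KA,\xi\rangle\langle KB,\xi\rangle\big),\qquad A,B\in T_\xi TM .$$ Let $\mathcal V^\varphi=\ker\varphi_*$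 and $\mathcal H^\varphi=(\mathcal V^\varphi)^\perp$, and let $\Gamma(\mathcal V^\varphi)$, $\Gamma(\mathcal H^\varphi)$ be the smooth vector fields on $M$ with values in $\mathcal V^\varphi$, $\mathcal H^\varphi$. Let $\Phi=\varphi_*:TM\to TN$, and for $\xi\in TM$ let $\mathcal V^\Phi_\xi=\ker\Phi_{*\xi}\subset T_\xi TM$, and let $\mathcal H^\Phi_\xi$ be the orthogonal complement of $\mathcal V^\Phi_\xi$ with respect to $h_{p,q,\alpha}$. (A metric on $N$ or on $TN$, such as $h_{r,s,\beta}$, does not enter into these notions.) Then for every $\xi\in TM$ the space $T_\xi TM$ is the orthogonal direct sum $\mathcal V^\Phi_\xi\oplus\mathcal H^\Phi_\xi$, and for every $\xi\neq 0$ $$\mathcal V^\Phi_\xi=\mathrm{Span}\{\eta^h_\xi+(\nabla_\xi\eta)^v_\xi \mid \eta\in\Gamma(\mathcal V^\varphi)\},$$ $$\mathcal H^\Phi_\xi=\mathrm{Span}\{X^v_\xi-q\,\omega_q(\xi)\langle X,\xi\rangle\,\xi^v_\xi+\omega_\alpha(\xi)^p(\nabla_\xi X)^h_\xi \mid X\in\Gamma(\mathcal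 H^\varphi)\}.$$ -/

import Mathlib

open Bundle Manifold VectorField FiberBundle
open scoped ContDiff

noncomputable section

namespace CheegerGromoll

section LeviCivita

/-! ### The Levi-Civita connection

`M` is a smooth manifold without boundary, modelled on a finite-dimensional space `E`, with a smooth
Riemannian metric on its tangent bundle. -/

variable {E : Type*} [NormedAddCommGroup E] [NormedSpace ℝ E]
  {M : Type*} [TopologicalSpace M] [ChartedSpace E M]
  [RiemannianBundle (fun x : M => TangentSpace 𝓘(ℝ, E) x)]

/-- The Koszul expression at `x`, that is
`1/2 (X⟨Y, Z⟩ + Y⟨X, Z⟩ - Z⟨X, Y⟩ + ⟨[X, Y], Z⟩ - ⟨[X, Z], Y⟩ - ⟨[Y, Z], X⟩)`;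
it is the value of `⟨∇_X Y, Z⟩` for the Levi-Civita connection `∇`. -/
def koszul (X Y Z : Π x : M, TangentSpace 𝓘(ℝ, E) x) (x : M) : ℝ :=
  (1 / 2 : ℝ) *
    (mvfderiv 𝓘(ℝ, E) (fun y => inner ℝ (Y y) (Z y)) x (X x)
      + mvfderiv 𝓘(ℝ, E) (fun y => inner ℝ (X y) (Z y)) x (Y x)
      - mvfderiv 𝓘(ℝ, E) (fun y => inner ℝ (X y) (Y y)) x (Z x)
      + inner ℝ (mlieBracket 𝓘(ℝ, E) X Y x) (Z x)
      - inner ℝ (mlieBracket 𝓘(ℝ, E) X Z x) (Y x)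
      - inner ℝ (mlieBracket 𝓘(ℝ, E) Y Z x) (X x))

variable [IsManifold 𝓘(ℝ, E) ∞ M]
  [IsContMDiffRiemannianBundle 𝓘(ℝ, E) ∞ E (fun x : M => TangentSpace 𝓘(ℝ, E) x)]

theorem mdifferentiableAt_inner {x : M} {Y Z : Π x : M, TangentSpace 𝓘(ℝ, E) x}
    (hY : MDiffAt (T% Y) x) (hZ : MDiffAt (T% Z) x) :
    MDiffAt (fun y => (inner ℝ (Y y) (Z y) : ℝ)) x :=
  MDifferentiableAt.inner_bundle (IB := 𝓘(ℝ, E)) (F := E)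
    (E := fun x : M => TangentSpace 𝓘(ℝ, E) x) hY hZ

variable [FiniteDimensional ℝ E]

theorem koszul_tensorial_left {x : M} {Y Z : Π x : M, TangentSpace 𝓘(ℝ, E) x}
    (hY : MDiffAt (T% Y) x) (hZ : MDiffAt (T% Z) x) :
    TensorialAt 𝓘(ℝ, E) E (fun X => koszul X Y Z x) x where
  smul {f X} hf hX := by
    simp [koszul, mvfderiv_fun_mul hf (mdifferentiableAt_inner hX hZ), mvfderiv_fun_mul hf (mdifferentiableAt_inner hX hY),
      mlieBracket_smul_left hf hX, inner_add_left, inner_smul_left, inner_smul_right]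
    ring
  add {X X'} hX hX' := by
    simp [koszul, mvfderiv_fun_add (mdifferentiableAt_inner hX hZ) (mdifferentiableAt_inner hX' hZ), mvfderiv_fun_add (mdifferentiableAt_inner hX hY) (mdifferentiableAt_inner hX' hY),
      mlieBracket_add_left hX hX', inner_add_left, inner_add_right]
    ring

theorem koszul_tensorial_right {x : M} {X Y : Π x : M, TangentSpace 𝓘(ℝ, E) x}
    (hX : MDiffAt (T% X) x) (hY : MDiffAt (T% Y) x) :
    TensorialAt 𝓘(ℝ, E) E (fun Z => koszul X Y Z x) x where
  smul {f Z} hf hZ := by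
    simp [koszul, mvfderiv_fun_mul hf (mdifferentiableAt_inner hX hZ), mvfderiv_fun_mul hf (mdifferentiableAt_inner hY hZ),
      mlieBracket_smul_right hf hZ, inner_add_left, inner_smul_left, inner_smul_right]
    simp [real_inner_comm]
    ring
  add {Z Z'} hZ hZ' := by
    simp [koszul, mvfderiv_fun_add (mdifferentiableAt_inner hX hZ) (mdifferentiableAt_inner hX hZ'), mvfderiv_fun_add (mdifferentiableAt_inner hY hZ) (mdifferentiableAt_inner hY hZ'),
      mlieBracket_add_right hZ hZ', inner_add_left, inner_add_right]
    ring

instance finiteDimensional_tangentSpace (x : M) :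
    FiniteDimensional ℝ (TangentSpace 𝓘(ℝ, E) x) :=
  inferInstanceAs (FiniteDimensional ℝ E)

/-- The bilinear form `(v, w) ↦ ⟨∇_v Y, w⟩` on `T_x M`: its value at `(X x, Z x)` is the Koszul
expression of `X, Y, Z`, for all vector fields `X`, `Z` that are differentiable at `x`. -/
def koszulForm (Y : Π x : M, TangentSpace 𝓘(ℝ, E) x) (x : M) (hY : MDiffAt (T% Y) x) :
    TangentSpace 𝓘(ℝ, E) x →L[ℝ] TangentSpace 𝓘(ℝ, E) x →L[ℝ] ℝ :=
  TensorialAt.mkHom₂ (fun X Z => koszul X Y Z x) x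
    (fun _ hZ => koszul_tensorial_left hY hZ) (fun _ hX => koszul_tensorial_right hX hY)

open Classical in
/-- The endomorphism `v ↦ ∇_v Y` of `T_x M`, for a vector field `Y` that is differentiable at `x`
(and the junk value `0` otherwise). -/
def leviCivitaFun (Y : Π x : M, TangentSpace 𝓘(ℝ, E) x) (x : M) :
    TangentSpace 𝓘(ℝ, E) x →L[ℝ] TangentSpace 𝓘(ℝ, E) x :=
  haveI : CompleteSpace (TangentSpace 𝓘(ℝ, E) x) := FiniteDimensional.complete ℝ _
  if hY : MDiffAt (T% Y) x then
    InnerProductSpace.continuousLinearMapOfBilin (𝕜 := ℝ) (koszulForm Y x hY)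
  else 0

theorem inner_leviCivitaFun {X Y Z : Π x : M, TangentSpace 𝓘(ℝ, E) x} {x : M}
    (hX : MDiffAt (T% X) x) (hY : MDiffAt (T% Y) x) (hZ : MDiffAt (T% Z) x) :
    inner ℝ (leviCivitaFun Y x (X x)) (Z x) = koszul X Y Z x := by
  have : CompleteSpace (TangentSpace 𝓘(ℝ, E) x) := FiniteDimensional.complete ℝ _
  rw [leviCivitaFun, dif_pos hY, InnerProductSpace.continuousLinearMapOfBilin_apply]
  exact TensorialAt.mkHom₂_apply _ _ hX hZ

theorem leviCivitaFun_ext {Y : Π x : M, TangentSpace 𝓘(ℝ, E) x} {x : M}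
    {L : TangentSpace 𝓘(ℝ, E) x →L[ℝ] TangentSpace 𝓘(ℝ, E) x} (hY : MDiffAt (T% Y) x)
    (h : ∀ X Z : Π x : M, TangentSpace 𝓘(ℝ, E) x, MDiffAt (T% X) x → MDiffAt (T% Z) x →
      koszul X Y Z x = inner ℝ (L (X x)) (Z x)) :
    leviCivitaFun Y x = L := by
  ext v
  refine ext_inner_right ℝ fun w => ?_
  have hv := mdifferentiableAt_extend 𝓘(ℝ, E) E v
  have hw := mdifferentiableAt_extend 𝓘(ℝ, E) E w
  have h1 := inner_leviCivitaFun hv hY hw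
  have h2 := h _ _ hv hw
  rw [extend_apply_self, extend_apply_self] at h1 h2
  rw [h1, h2]

variable (E M) in
/-- The Levi-Civita connection of `M`; `leviCivita E M Y x v` is `∇_v Y`. -/
def leviCivita : CovariantDerivative 𝓘(ℝ, E) E (TangentSpace 𝓘(ℝ, E) : M → Type _) where
  toFun := leviCivitaFun
  isCovariantDerivativeOnUniv :=
    { add := fun {Y Y' x} hY hY' _ => by
        refine leviCivitaFun_ext (mdifferentiableAt_add_section hY hY') fun X Z hX hZ => ?_
        have h1 := inner_leviCivitaFun hX hY hZ
        have h2 := inner_leviCivitaFun hX hY' hZ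
        rw [_root_.add_apply, inner_add_left, h1, h2]
        simp [koszul, mvfderiv_fun_add (mdifferentiableAt_inner hY hZ) (mdifferentiableAt_inner hY' hZ), mvfderiv_fun_add (mdifferentiableAt_inner hX hY) (mdifferentiableAt_inner hX hY'),
          mlieBracket_add_left hY hY', mlieBracket_add_right hY hY', inner_add_left, inner_add_right]
        ring
      leibniz := fun {Y f x} hY hf _ => by
        refine leviCivitaFun_ext (hf.smul_section hY) fun X Z hX hZ => ?_
        have h1 := inner_leviCivitaFun hX hY hZ
        rw [_root_.add_apply, inner_add_left, _root_.smul_apply, inner_smul_left, h1]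
        simp [koszul, mvfderiv_fun_mul hf (mdifferentiableAt_inner hY hZ), mvfderiv_fun_mul hf (mdifferentiableAt_inner hX hY),
          mlieBracket_smul_left hf hY, mlieBracket_smul_right hf hY, inner_add_left, inner_smul_left, inner_smul_right]
        simp [real_inner_comm]
        ring }

/-- The Levi-Civita connection is torsion-free. -/
theorem leviCivita_torsion : (leviCivita E M).torsion = 0 := by
  rw [CovariantDerivative.torsion_eq_zero_iff]
  intro X Y x hX hY
  refine ext_inner_right ℝ fun w => ?_
  have hw := mdifferentiableAt_extend 𝓘(ℝ, E) E w
  have h1 := inner_leviCivitaFun hX hY hw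
  have h2 := inner_leviCivitaFun hY hX hw
  rw [extend_apply_self] at h1 h2
  rw [inner_sub_left]
  change inner ℝ (leviCivitaFun Y x (X x)) w - inner ℝ (leviCivitaFun X x (Y x)) w = _
  rw [h1, h2, koszul, koszul, mlieBracket_swap_apply (V := Y) (W := X)]
  simp [real_inner_comm]
  ring

/-- The Levi-Civita connection is compatible with the metric. -/
theorem leviCivita_metric {X Y Z : Π x : M, TangentSpace 𝓘(ℝ, E) x} {x : M}
    (hX : MDiffAt (T% X) x) (hY : MDiffAt (T% Y) x) (hZ : MDiffAt (T% Z) x) :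
    mvfderiv 𝓘(ℝ, E) (fun y => inner ℝ (Y y) (Z y)) x (X x)
      = inner ℝ (leviCivita E M Y x (X x)) (Z x) + inner ℝ (Y x) (leviCivita E M Z x (X x)) := by
  have h1 := inner_leviCivitaFun hX hY hZ
  have h2 := inner_leviCivitaFun hX hZ hY
  change _ = inner ℝ (leviCivitaFun Y x (X x)) (Z x) + inner ℝ (Y x) (leviCivitaFun Z x (X x))
  rw [h1, real_inner_comm, h2, koszul, koszul, mlieBracket_swap_apply (V := Z) (W := Y)]
  simp [real_inner_comm]
  ring

theorem leviCivita_sum {ι : Type*} (s : Finset ι) (σ : ι → Π x : M, TangentSpace 𝓘(ℝ, E) x) {x : M}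
    (hσ : ∀ i ∈ s, MDiffAt (T% (σ i)) x) :
    leviCivita E M (∑ i ∈ s, σ i) x = ∑ i ∈ s, leviCivita E M (σ i) x ∧
      MDiffAt (T% (∑ i ∈ s, σ i)) x := by
  classical
  induction s using Finset.induction_on with
  | empty =>
    refine ⟨?_, ?_⟩
    · rw [Finset.sum_empty, Finset.sum_empty]
      exact (leviCivita E M).isCovariantDerivativeOn.zero
    · exact mdifferentiableAt_zeroSection ..
  | insert a s ha ih =>
    simp only [Finset.mem_insert, forall_eq_or_imp] at hσ
    obtain ⟨h1, h2⟩ := ih hσ.2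
    rw [Finset.sum_insert ha, Finset.sum_insert ha]
    refine ⟨?_, mdifferentiableAt_add_section hσ.1 h2⟩
    rw [← h1]
    exact (leviCivita E M).isCovariantDerivativeOn.add hσ.1 h2

/-! ### The connection map and the splitting of `TTM` -/

/-- The fibre coordinate on `TM` in the local trivialization of `TM` at `x`. -/
def fibreCoord (x : M) (ζ : TangentBundle 𝓘(ℝ, E) M) : E :=
  (trivializationAt E (TangentSpace 𝓘(ℝ, E) : M → Type _) x ζ).2

/-- The local vector field through `ξ ∈ T_x M` with constant fibre coordinate in the local
trivialization of `TM` at `x`. -/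
def constSection (ξ : TangentBundle 𝓘(ℝ, E) M) (y : M) : TangentSpace 𝓘(ℝ, E) y :=
  (trivializationAt E (TangentSpace 𝓘(ℝ, E) : M → Type _) ξ.proj).symm y (fibreCoord ξ.proj ξ)

/-- The differential `π_* : T_ξ TM → T_x M` of the projection `π : TM → M`, where `x = π ξ`. -/
def projDeriv (ξ : TangentBundle 𝓘(ℝ, E) M) :
    TangentSpace 𝓘(ℝ, E).tangent ξ →L[ℝ] TangentSpace 𝓘(ℝ, E) ξ.proj :=
  mfderiv 𝓘(ℝ, E).tangent 𝓘(ℝ, E) (TotalSpace.proj : TangentBundle 𝓘(ℝ, E) M → M) ξ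

/-- The connection map `K : T_ξ TM → T_x M` of the Levi-Civita connection, where `x = π ξ`. In the
local trivialization of `TM` at `x`, the vector `K A` is the derivative along `A` of the fibre
coordinate plus the Christoffel term, which is the covariant derivative along `π_* A` of the vector
field through `ξ` with constant fibre coordinate. By `connectionMap_mfderiv`,
`K (Y_* v) = ∇_v Y` for every vector field `Y`. -/
def connectionMap (ξ : TangentBundle 𝓘(ℝ, E) M) :
    TangentSpace 𝓘(ℝ, E).tangent ξ →L[ℝ] TangentSpace 𝓘(ℝ, E) ξ.proj :=
  (trivializationAt E (TangentSpace 𝓘(ℝ, E) : M → Type _) ξ.proj).symmL ℝ ξ.proj ∘L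
      mvfderiv 𝓘(ℝ, E).tangent (fibreCoord ξ.proj) ξ
    + leviCivita E M (constSection ξ) ξ.proj ∘L projDeriv ξ

/-- The defining property of the connection map, `K (Y_* v) = ∇_v Y`. -/
theorem connectionMap_mfderiv {Y : Π x : M, TangentSpace 𝓘(ℝ, E) x} {x : M}
    (hY : MDiffAt (T% Y) x) (v : TangentSpace 𝓘(ℝ, E) x) :
    connectionMap (⟨x, Y x⟩ : TangentBundle 𝓘(ℝ, E) M)
        (mfderiv 𝓘(ℝ, E) 𝓘(ℝ, E).tangent
          (fun y => (⟨y, Y y⟩ : TangentBundle 𝓘(ℝ, E) M)) x v)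
      = leviCivita E M Y x v := by
  set ξ : TangentBundle 𝓘(ℝ, E) M := ⟨x, Y x⟩ with hξd
  set e := trivializationAt E (TangentSpace 𝓘(ℝ, E) : M → Type _) x with he
  have hx : x ∈ e.baseSet := FiberBundle.mem_baseSet_trivializationAt' x
  have hξ : ξ ∈ e.source := e.mem_source.2 hx
  have hd : MDifferentiableAt 𝓘(ℝ, E).tangent (𝓘(ℝ, E).prod 𝓘(ℝ, E)) e ξ :=
    ((e.contMDiffOn (n := 1) (IB := 𝓘(ℝ, E))).contMDiffAt
      (e.open_source.mem_nhds hξ)).mdifferentiableAt one_ne_zero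
  have hp : MDifferentiableAt 𝓘(ℝ, E).tangent 𝓘(ℝ, E)
      (TotalSpace.proj : TangentBundle 𝓘(ℝ, E) M → M) ξ :=
    (Bundle.contMDiff_proj (n := 1) _).contMDiffAt.mdifferentiableAt one_ne_zero
  have hc : MDifferentiableAt 𝓘(ℝ, E).tangent 𝓘(ℝ, E) (fibreCoord x) ξ :=
    (mdifferentiableAt_snd).comp ξ hd
  let c : M → E := fun y => fibreCoord x (⟨y, Y y⟩ : TangentBundle 𝓘(ℝ, E) M)
  have hcd : MDifferentiableAt 𝓘(ℝ, E) 𝓘(ℝ, E) c x :=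
    MDifferentiableAt.comp (f := fun y => (⟨y, Y y⟩ : TangentBundle 𝓘(ℝ, E) M)) (g := fibreCoord x)
      x hc hY
  have hproj : projDeriv ξ (mfderiv 𝓘(ℝ, E) 𝓘(ℝ, E).tangent
          (fun y => (⟨y, Y y⟩ : TangentBundle 𝓘(ℝ, E) M)) x v) = v := by
    have := mfderiv_comp x hp hY
    have h2 : ((TotalSpace.proj : TangentBundle 𝓘(ℝ, E) M → M) ∘
      (fun y => (⟨y, Y y⟩ : TangentBundle 𝓘(ℝ, E) M))) = id := rfl
    rw [h2, mfderiv_id] at this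
    exact (congrArg (fun L => L v) this).symm
  have hcoord : mvfderiv 𝓘(ℝ, E).tangent (fibreCoord x) ξ (mfderiv 𝓘(ℝ, E) 𝓘(ℝ, E).tangent
          (fun y => (⟨y, Y y⟩ : TangentBundle 𝓘(ℝ, E) M)) x v) = mvfderiv 𝓘(ℝ, E) c x v := by
    have := mfderiv_comp x hc hY
    exact (congrArg (fun L => L v) this).symm
  let b := Module.finBasis ℝ E
  let s : Fin (Module.finrank ℝ E) → Π y : M, TangentSpace 𝓘(ℝ, E) y := fun i y => e.symm y (b i)
  let f : Fin (Module.finrank ℝ E) → M → ℝ := fun i y => (b.coord i).toContinuousLinearMap (c y - c x)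
  have hs : ∀ w : E, MDiffAt (T% (fun y => (e.symm y w : TangentSpace 𝓘(ℝ, E) y))) x := by
    intro w
    have := mdifferentiableAt_extend 𝓘(ℝ, E) E (e.symm x w : TangentSpace 𝓘(ℝ, E) x)
    convert this using 3 with y
    simp only [extend]
    rw [← he, e.apply_mk_symm hx]
  have hf : ∀ i, MDiffAt (f i) x := fun i =>
    ((b.coord i).toContinuousLinearMap.differentiableAt.mdifferentiableAt).comp x
      (hcd.sub mdifferentiableAt_const)
  have hfx : ∀ i, f i x = 0 := fun i => by simp [f]
  have hconst : MDiffAt (T% (constSection ξ)) x := hs _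
  obtain ⟨hsum, hsumd⟩ := leviCivita_sum Finset.univ (fun i => f i • s i) (x := x)
    (fun i _ => (hf i).smul_section (hs (b i)))
  have hev : ∀ᶠ y in nhds x, Y y = (constSection ξ + ∑ i, f i • s i) y := by
    filter_upwards [e.open_baseSet.mem_nhds hx] with y hy
    have h1 : Y y = e.symm y (c y) := by
      have := e.symm_proj_apply (⟨y, Y y⟩ : TangentBundle 𝓘(ℝ, E) M) hy
      exact this.symm
    have h2 : c y = fibreCoord x ξ + ∑ i, f i y • b i := by
      have := b.sum_repr (c y - c x)
      change c y = c x + _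
      rw [← sub_eq_iff_eq_add', ← this]
      rfl
    rw [h1, h2, Pi.add_apply, Finset.sum_apply]
    change e.symm y _ = e.symm y (fibreCoord x ξ) + ∑ i, f i y • e.symm y (b i)
    simp only [← e.symmL_apply (R := ℝ) hy, map_add, map_sum, map_smul]
  rw [(leviCivita E M).isCovariantDerivativeOn.congr_of_eventuallyEq hY
    (mdifferentiableAt_add_section hconst hsumd) Filter.univ_mem hev,
    (leviCivita E M).isCovariantDerivativeOn.add hconst hsumd]
  rw [connectionMap, _root_.add_apply, ContinuousLinearMap.comp_apply, 
      ContinuousLinearMap.comp_apply, hproj, hcoord, _root_.add_apply, add_comm]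
  congr 1
  rw [hsum, _root_.sum_apply]
  have h1 : ∀ i, leviCivita E M (f i • s i) x v = mvfderiv 𝓘(ℝ, E) (f i) x v • s i x := by
    intro i
    rw [(leviCivita E M).isCovariantDerivativeOn.leibniz (hs (b i)) (hf i), hfx i, zero_smul,
      zero_add]
    rfl
  have h2 : ∀ i, mvfderiv 𝓘(ℝ, E) (f i) x v = b.coord i (mvfderiv 𝓘(ℝ, E) c x v) := by
    intro i
    have h3 : MDiffAt (fun y => c y - c x) x := hcd.sub mdifferentiableAt_const
    have h4 := mvfderiv_comp_apply (I := 𝓘(ℝ, E)) (g := (b.coord i).toContinuousLinearMap) x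
      (b.coord i).toContinuousLinearMap.differentiableAt.mdifferentiableAt h3 v
    have h5 := mvfderiv_fun_sub hcd (mdifferentiableAt_const (c := c x))
    rw [mvfderiv_const, sub_zero] at h5
    rw [← h5]
    refine h4.trans ?_
    rw [mvfderiv, mfderiv_eq_fderiv, ContinuousLinearMap.fderiv]
    rfl
  simp only [h1, h2]
  change e.symmL ℝ x _ = ∑ i, b.coord i (mvfderiv 𝓘(ℝ, E) c x v) • e.symm x (b i)
  simp only [← e.symmL_apply (R := ℝ) hx, ← map_smul, ← map_sum]
  congr 1
  exact (b.sum_repr _).symm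

theorem eq_zero_of_projDeriv_of_connectionMap {ξ : TangentBundle 𝓘(ℝ, E) M}
    {A : TangentSpace 𝓘(ℝ, E).tangent ξ} (h1 : projDeriv ξ A = 0) (h2 : connectionMap ξ A = 0) :
    A = 0 := by
  set e := trivializationAt E (TangentSpace 𝓘(ℝ, E) : M → Type _) ξ.proj with he
  have hx : ξ.proj ∈ e.baseSet := FiberBundle.mem_baseSet_trivializationAt' ξ.proj
  have hξ : ξ ∈ e.source := e.mem_source.2 hx
  have h3 : mvfderiv 𝓘(ℝ, E).tangent (fibreCoord ξ.proj) ξ A = 0 := by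
    rw [connectionMap, _root_.add_apply, ContinuousLinearMap.comp_apply, 
      ContinuousLinearMap.comp_apply, h1, map_zero, add_zero] at h2
    have := congrArg (e.continuousLinearMapAt ℝ ξ.proj) h2
    rwa [map_zero, e.continuousLinearMapAt_symmL hx] at this
  have hd : MDifferentiableAt 𝓘(ℝ, E).tangent (𝓘(ℝ, E).prod 𝓘(ℝ, E)) e ξ :=
    ((e.contMDiffOn (n := 1) (IB := 𝓘(ℝ, E))).contMDiffAt
      (e.open_source.mem_nhds hξ)).mdifferentiableAt one_ne_zero
  have hd' : MDifferentiableAt (𝓘(ℝ, E).prod 𝓘(ℝ, E)) 𝓘(ℝ, E).tangent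
      e.toOpenPartialHomeomorph.symm (e ξ) :=
    ((e.contMDiffOn_symm (n := 1) (IB := 𝓘(ℝ, E))).contMDiffAt
      (e.open_target.mem_nhds (e.map_source hξ))).mdifferentiableAt one_ne_zero
  have hp : MDifferentiableAt 𝓘(ℝ, E).tangent 𝓘(ℝ, E)
      (TotalSpace.proj : TangentBundle 𝓘(ℝ, E) M → M) ξ :=
    (Bundle.contMDiff_proj (n := 1) _).contMDiffAt.mdifferentiableAt one_ne_zero
  have hc : MDifferentiableAt 𝓘(ℝ, E).tangent 𝓘(ℝ, E) (fibreCoord ξ.proj) ξ :=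
    (mdifferentiableAt_snd).comp ξ hd
  have h4 : mfderiv 𝓘(ℝ, E).tangent (𝓘(ℝ, E).prod 𝓘(ℝ, E)) e ξ A = 0 := by
    have h5 : e =ᶠ[nhds ξ] fun ζ => (ζ.proj, fibreCoord ξ.proj ζ) := by
      filter_upwards [e.open_source.mem_nhds hξ] with ζ hζ
      exact Prod.ext (e.coe_fst hζ) rfl
    rw [h5.mfderiv_eq, mfderiv_prodMk hp hc]
    exact Prod.ext h1 h3
  have h6 := mfderiv_comp ξ hd' hd
  have h7 : (e.toOpenPartialHomeomorph.symm ∘ e) =ᶠ[nhds ξ] id := by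
    filter_upwards [e.open_source.mem_nhds hξ] with ζ hζ
    exact e.toOpenPartialHomeomorph.left_inv hζ
  rw [h7.mfderiv_eq, mfderiv_id] at h6
  have h8 := congrArg (fun L => L A) h6
  simp only [ContinuousLinearMap.comp_apply] at h8
  rw [h4, map_zero] at h8
  exact h8

/-- The isomorphism `(π_*, K) : T_ξ TM → T_x M × T_x M`. -/
def splitting (ξ : TangentBundle 𝓘(ℝ, E) M) :
    TangentSpace 𝓘(ℝ, E).tangent ξ ≃ₗ[ℝ]
      TangentSpace 𝓘(ℝ, E) ξ.proj × TangentSpace 𝓘(ℝ, E) ξ.proj :=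
  haveI : FiniteDimensional ℝ (TangentSpace 𝓘(ℝ, E).tangent ξ) :=
    inferInstanceAs (FiniteDimensional ℝ (E × E))
  LinearMap.linearEquivOfInjective
    ((projDeriv ξ).toLinearMap.prod (connectionMap ξ).toLinearMap)
    ((injective_iff_map_eq_zero _).2 fun _ hA =>
      eq_zero_of_projDeriv_of_connectionMap (congrArg Prod.fst hA) (congrArg Prod.snd hA))
    rfl

/-- The horizontal lift `X^h_ξ`: the unique vector of `T_ξ TM` with `π_* X^h_ξ = X` and
`K X^h_ξ = 0`. -/
def horizontalLift (ξ : TangentBundle 𝓘(ℝ, E) M) (X : TangentSpace 𝓘(ℝ, E) ξ.proj) :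
    TangentSpace 𝓘(ℝ, E).tangent ξ :=
  (splitting ξ).symm (X, 0)

/-- The vertical lift `X^v_ξ`: the unique vector of `T_ξ TM` with `π_* X^v_ξ = 0` and
`K X^v_ξ = X`. -/
def verticalLift (ξ : TangentBundle 𝓘(ℝ, E) M) (X : TangentSpace 𝓘(ℝ, E) ξ.proj) :
    TangentSpace 𝓘(ℝ, E).tangent ξ :=
  (splitting ξ).symm (0, X)

/-! ### Cheeger-Gromoll type metrics -/

/-- `ω_a(ξ) = (1 + a ⟨ξ, ξ⟩)⁻¹`. -/
def omegaCG (a : ℝ) (ξ : TangentBundle 𝓘(ℝ, E) M) : ℝ :=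
  (1 + a * inner ℝ ξ.snd ξ.snd)⁻¹

/-- The Cheeger-Gromoll type metric `h_{p,q,α}` on `TM`, as a bilinear form on `T_ξ TM`:
`h(A, B) = ⟨π_* A, π_* B⟩ + ω_α(ξ)^p (⟨K A, K B⟩ + q ⟨K A, ξ⟩ ⟨K B, ξ⟩)`. -/
def cgMetric (p q α : ℝ) (ξ : TangentBundle 𝓘(ℝ, E) M) :
    LinearMap.BilinForm ℝ (TangentSpace 𝓘(ℝ, E).tangent ξ) :=
  LinearMap.mk₂ ℝ
    (fun A B => inner ℝ (projDeriv ξ A) (projDeriv ξ B)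
      + omegaCG α ξ ^ p * (inner ℝ (connectionMap ξ A) (connectionMap ξ B)
        + q * inner ℝ (connectionMap ξ A) ξ.snd * inner ℝ (connectionMap ξ B) ξ.snd))
    (fun A A' B => by simp only [map_add, inner_add_left]; ring)
    (fun c A B => by simp only [map_smul, real_inner_smul_left, smul_eq_mul]; ring)
    (fun A B B' => by simp only [map_add, inner_add_left, inner_add_right]; ring)
    (fun c A B => by
      simp only [map_smul, real_inner_smul_left, real_inner_smul_right, smul_eq_mul]; ring)

end LeviCivita

/-! ### Submersions, vertical and horizontal spaces -/

section Vertical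

variable {E : Type*} [NormedAddCommGroup E] [NormedSpace ℝ E]
  {H : Type*} [TopologicalSpace H] {I : ModelWithCorners ℝ E H}
  {M : Type*} [TopologicalSpace M] [ChartedSpace H M]
  {F : Type*} [NormedAddCommGroup F] [NormedSpace ℝ F]
  {G : Type*} [TopologicalSpace G] {J : ModelWithCorners ℝ F G}
  {N : Type*} [TopologicalSpace N] [ChartedSpace G N]

variable (I J) in
/-- The vertical space at `x` of a map `f`: the kernel of its differential at `x`. -/
def verticalSpace (f : M → N) (x : M) : Submodule ℝ (TangentSpace I x) :=
  LinearMap.ker (mfderiv I J f x).toLinearMap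

variable (I J) in
/-- A smooth submersion: a smooth surjective map whose differential is surjective at every point. -/
structure IsSmoothSubmersion (f : M → N) : Prop where
  contMDiff : ContMDiff I J ∞ f
  surjective : Function.Surjective f
  surjective_mfderiv : ∀ x, Function.Surjective (mfderiv I J f x)

end Vertical

section Fields

variable {E : Type*} [NormedAddCommGroup E] [NormedSpace ℝ E]
  {M : Type*} [TopologicalSpace M] [ChartedSpace E M] [IsManifold 𝓘(ℝ, E) ∞ M]
  {F : Type*} [NormedAddCommGroup F] [NormedSpace ℝ F]
  {N : Type*} [TopologicalSpace N] [ChartedSpace F N] [IsManifold 𝓘(ℝ, F) ∞ N]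

/-- `η ∈ Γ(𝒱^φ)`: a smooth vector field on `M`, vertical at every point. -/
structure IsVerticalField (φ : M → N) (η : Π x : M, TangentSpace 𝓘(ℝ, E) x) : Prop where
  contMDiff : ContMDiff 𝓘(ℝ, E) 𝓘(ℝ, E).tangent ∞
    (fun x => (⟨x, η x⟩ : TangentBundle 𝓘(ℝ, E) M))
  vertical : ∀ x, η x ∈ verticalSpace 𝓘(ℝ, E) 𝓘(ℝ, F) φ x

/-- `X ∈ Γ(ℋ^φ)`: a smooth vector field on `M`, orthogonal to the vertical space at every point. -/
structure IsHorizontalField [RiemannianBundle (fun x : M => TangentSpace 𝓘(ℝ, E) x)]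
    (φ : M → N) (X : Π x : M, TangentSpace 𝓘(ℝ, E) x) : Prop where
  contMDiff : ContMDiff 𝓘(ℝ, E) 𝓘(ℝ, E).tangent ∞
    (fun x => (⟨x, X x⟩ : TangentBundle 𝓘(ℝ, E) M))
  horizontal : ∀ x, X x ∈ (verticalSpace 𝓘(ℝ, E) 𝓘(ℝ, F) φ x)ᗮ

/-- The vertical space at `ξ` of `Φ = φ_* : TM → TN`, that is the kernel of `Φ_*` in `T_ξ TM`. -/
def verticalSpaceTangent (φ : M → N) (ξ : TangentBundle 𝓘(ℝ, E) M) :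
    Submodule ℝ (TangentSpace 𝓘(ℝ, E).tangent ξ) :=
  verticalSpace 𝓘(ℝ, E).tangent 𝓘(ℝ, F).tangent (tangentMap 𝓘(ℝ, E) 𝓘(ℝ, F) φ) ξ

/-- The horizontal space at `ξ` of `Φ = φ_* : TM → TN`, that is the orthogonal complement of its
vertical space with respect to the metric `h_{p,q,α}` on `TM`. -/
def horizontalSpaceTangent [FiniteDimensional ℝ E]
    [RiemannianBundle (fun x : M => TangentSpace 𝓘(ℝ, E) x)]
    [IsContMDiffRiemannianBundle 𝓘(ℝ, E) ∞ E (fun x : M => TangentSpace 𝓘(ℝ, E) x)]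
    (p q α : ℝ) (φ : M → N) (ξ : TangentBundle 𝓘(ℝ, E) M) :
    Submodule ℝ (TangentSpace 𝓘(ℝ, E).tangent ξ) :=
  (cgMetric p q α ξ).orthogonal (verticalSpaceTangent (F := F) φ ξ)

end Fields

end CheegerGromoll

end

open CheegerGromoll

/-!
The vector `η^h + (∇_ξ η)^v` at `ξ` is the complete lift of the vector field `η`, the velocity of the
flow on `TM` induced by the flow of `η`. As the flow of a vertical field preserves `φ`, its complete
lift is annihilated by `Φ_*`, where `Φ = φ_*`. The proof of this fact is a computation in charts: by
the vanishing of the torsion, the fibre coordinate of the complete lift is the derivative `∂_ξ η` of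
the fibre coordinate of `η` (`mvfderiv_fibreCoord_completeLift`), so `Φ_*` sends it to
`D²φ(η, ξ) + Dφ(∂_ξ η)`, the derivative along `ξ` of `Dφ(η) = 0`
(`completeLift_mem_verticalSpaceTangent`).

Conversely, a vector `A` of `ker Φ_*` projects to a vertical vector of `M`, and is the vertical lift
of a vertical vector if its projection is zero. So `A` is a combination of two complete lifts, provided
that vertical vectors extend to global vertical fields (`exists_isVerticalField`) and that for `ξ ≠ 0`
there is a function `f` with `f = 0` and `∂_ξ f = 1` at the base point: the complete lift of `f ζ` is
then the vertical lift of `ζ`.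

The generators of the horizontal space are orthogonal to the complete lifts of vertical fields because
`⟨η, X⟩ = 0` implies `⟨∇_ξ η, X⟩ + ⟨η, ∇_ξ X⟩ = 0` (`horizontalGenerator_mem`). That they span the
orthogonal complement is shown as for the vertical space, with global horizontal fields through given
horizontal vectors (`exists_isHorizontalField`): the field `X` is found from the image of the vector
under `K`, and the remaining horizontal part is reached with a field `f Y`. Finally, `h_{p,q,α}` is
positive definite for `q ≥ 0` and `α > 0`, so that a subspace and its orthogonal complement are
complementary.
-/

noncomputable section

namespace CheegerGromoll

/-! ### A smooth map read in charts -/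

section Chart

variable {E : Type*} [NormedAddCommGroup E] {M : Type*} [TopologicalSpace M] [ChartedSpace E M]
  {F : Type*} [NormedAddCommGroup F] {N : Type*} [TopologicalSpace N] [ChartedSpace F N]

/-- The open set of points of `M` where the expression of `φ` in the preferred charts at `x` and
`φ x` is meaningful. The model spaces `E` and `F` cannot be inferred from the arguments. -/
def chartDomain (φ : M → N) (x : M) : Set M :=
  (chartAt E x).source ∩ φ ⁻¹' (chartAt F (φ x)).source

theorem isOpen_chartDomain {φ : M → N} (hφ : Continuous φ) (x : M) :
    IsOpen (chartDomain (E := E) (F := F) φ x) :=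
  (chartAt E x).open_source.inter ((chartAt F (φ x)).open_source.preimage hφ)

theorem mem_chartDomain (φ : M → N) (x : M) : x ∈ chartDomain (E := E) (F := F) φ x :=
  ⟨mem_chart_source E x, mem_chart_source F (φ x)⟩

variable [NormedSpace ℝ E] [NormedSpace ℝ F] [IsManifold 𝓘(ℝ, E) ∞ M] [IsManifold 𝓘(ℝ, F) ∞ N]

theorem contDiffAt_writtenInExtChartAt {φ : M → N} (hφ : ContMDiff 𝓘(ℝ, E) 𝓘(ℝ, F) ∞ φ)
    {x y : M} (hy : y ∈ chartDomain (E := E) (F := F) φ x) :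
    ContDiffAt ℝ ∞ (writtenInExtChartAt 𝓘(ℝ, E) 𝓘(ℝ, F) x φ) (extChartAt 𝓘(ℝ, E) x y) := by
  have h := (contMDiffOn_iff.1 (contMDiffOn_univ.2 hφ)).2 x (φ x)
  refine h.contDiffAt (IsOpen.mem_nhds ?_ ?_)
  · simp only [Set.univ_inter]
    refine (continuousOn_extChartAt_symm x).isOpen_inter_preimage (isOpen_extChartAt_target x) ?_
    exact (isOpen_extChartAt_source (φ x)).preimage hφ.continuous
  · have h1 : y ∈ (extChartAt 𝓘(ℝ, E) x).source := by simpa using hy.1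
    refine ⟨(extChartAt 𝓘(ℝ, E) x).map_source h1, trivial, ?_⟩
    change φ ((extChartAt 𝓘(ℝ, E) x).symm _) ∈ (extChartAt 𝓘(ℝ, F) (φ x)).source
    rw [(extChartAt 𝓘(ℝ, E) x).left_inv h1]
    simpa using hy.2

/-- In the trivializations of `TM` at `x` and of `TN` at `φ x`, the differential of `φ` is the
derivative of `φ` read in charts. -/
theorem continuousLinearMapAt_mfderiv {φ : M → N} (hφ : ContMDiff 𝓘(ℝ, E) 𝓘(ℝ, F) ∞ φ)
    {x y : M} (hy : y ∈ chartDomain (E := E) (F := F) φ x) (w : TangentSpace 𝓘(ℝ, E) y) :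
    (trivializationAt F (TangentSpace 𝓘(ℝ, F) : N → Type _) (φ x)).continuousLinearMapAt ℝ (φ y)
        (mfderiv 𝓘(ℝ, E) 𝓘(ℝ, F) φ y w)
      = fderiv ℝ (writtenInExtChartAt 𝓘(ℝ, E) 𝓘(ℝ, F) x φ) (extChartAt 𝓘(ℝ, E) x y)
        ((trivializationAt E (TangentSpace 𝓘(ℝ, E) : M → Type _) x).continuousLinearMapAt ℝ y w)
      := by
  rw [TangentBundle.continuousLinearMapAt_trivializationAt hy.1,
    TangentBundle.continuousLinearMapAt_trivializationAt hy.2]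
  have h1 := mfderiv_comp (I'' := 𝓘(ℝ, F)) y
    (mdifferentiableAt_extChartAt (I := 𝓘(ℝ, F)) hy.2)
    (hφ.mdifferentiableAt (x := y) (by simp))
  have h2 := mfderiv_comp (I'' := 𝓘(ℝ, F)) y
    (((contDiffAt_writtenInExtChartAt hφ hy).differentiableAt (by simp)).mdifferentiableAt)
    (mdifferentiableAt_extChartAt (I := 𝓘(ℝ, E)) hy.1)
  have h3 : (extChartAt 𝓘(ℝ, F) (φ x) ∘ φ) =ᶠ[nhds y]
      (writtenInExtChartAt 𝓘(ℝ, E) 𝓘(ℝ, F) x φ) ∘ extChartAt 𝓘(ℝ, E) x := by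
    filter_upwards [(chartAt E x).open_source.mem_nhds hy.1] with z hz
    simp only [writtenInExtChartAt, Function.comp_apply]
    rw [(extChartAt 𝓘(ℝ, E) x).left_inv (by simpa using hz)]
  rw [← h3.mfderiv_eq, h1, mfderiv_eq_fderiv] at h2
  exact congrArg (fun L => L w) h2

end Chart

/-! ### The tangent map in fibre coordinates -/

section TangentMap

variable {E : Type*} [NormedAddCommGroup E] [NormedSpace ℝ E]
  {M : Type*} [TopologicalSpace M] [ChartedSpace E M] [IsManifold 𝓘(ℝ, E) ∞ M]
  {F : Type*} [NormedAddCommGroup F] [NormedSpace ℝ F]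
  {N : Type*} [TopologicalSpace N] [ChartedSpace F N] [IsManifold 𝓘(ℝ, F) ∞ N]

theorem mdifferentiableAt_proj (ξ : TangentBundle 𝓘(ℝ, E) M) :
    MDifferentiableAt 𝓘(ℝ, E).tangent 𝓘(ℝ, E)
      (TotalSpace.proj : TangentBundle 𝓘(ℝ, E) M → M) ξ :=
  (Bundle.contMDiff_proj (n := 1) _).contMDiffAt.mdifferentiableAt one_ne_zero

theorem mdifferentiableAt_trivializationAt (ξ : TangentBundle 𝓘(ℝ, E) M) :
    MDifferentiableAt 𝓘(ℝ, E).tangent (𝓘(ℝ, E).prod 𝓘(ℝ, E))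
      (trivializationAt E (TangentSpace 𝓘(ℝ, E) : M → Type _) ξ.proj) ξ := by
  set e := trivializationAt E (TangentSpace 𝓘(ℝ, E) : M → Type _) ξ.proj
  exact ((e.contMDiffOn (n := 1) (IB := 𝓘(ℝ, E))).contMDiffAt (e.open_source.mem_nhds
    (e.mem_source.2 (FiberBundle.mem_baseSet_trivializationAt' ξ.proj)))).mdifferentiableAt
      one_ne_zero

theorem mdifferentiableAt_fibreCoord (ξ : TangentBundle 𝓘(ℝ, E) M) :
    MDifferentiableAt 𝓘(ℝ, E).tangent 𝓘(ℝ, E) (fibreCoord ξ.proj) ξ :=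
  mdifferentiableAt_snd.comp ξ (mdifferentiableAt_trivializationAt ξ)

/-- A vector of `T_ξ TM` is determined by the derivatives along it of the projection and of the
fibre coordinate. -/
theorem eq_zero_of_projDeriv_of_fibreCoord {ξ : TangentBundle 𝓘(ℝ, E) M}
    {A : TangentSpace 𝓘(ℝ, E).tangent ξ} (h1 : projDeriv ξ A = 0)
    (h2 : mvfderiv 𝓘(ℝ, E).tangent (fibreCoord ξ.proj) ξ A = 0) : A = 0 := by
  set e := trivializationAt E (TangentSpace 𝓘(ℝ, E) : M → Type _) ξ.proj with he
  have hξ : ξ ∈ e.source := e.mem_source.2 (FiberBundle.mem_baseSet_trivializationAt' ξ.proj)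
  have hd : MDifferentiableAt 𝓘(ℝ, E).tangent (𝓘(ℝ, E).prod 𝓘(ℝ, E)) e ξ :=
    mdifferentiableAt_trivializationAt ξ
  have hd' : MDifferentiableAt (𝓘(ℝ, E).prod 𝓘(ℝ, E)) 𝓘(ℝ, E).tangent
      e.toOpenPartialHomeomorph.symm (e ξ) :=
    ((e.contMDiffOn_symm (n := 1) (IB := 𝓘(ℝ, E))).contMDiffAt
      (e.open_target.mem_nhds (e.map_source hξ))).mdifferentiableAt one_ne_zero
  have h4 : mfderiv 𝓘(ℝ, E).tangent (𝓘(ℝ, E).prod 𝓘(ℝ, E)) e ξ A = 0 := by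
    have h5 : e =ᶠ[nhds ξ] fun ζ => (ζ.proj, fibreCoord ξ.proj ζ) := by
      filter_upwards [e.open_source.mem_nhds hξ] with ζ hζ
      exact Prod.ext (e.coe_fst hζ) rfl
    rw [h5.mfderiv_eq, mfderiv_prodMk (mdifferentiableAt_proj ξ) (mdifferentiableAt_fibreCoord ξ)]
    exact Prod.ext h1 h2
  have h6 := mfderiv_comp ξ hd' hd
  have h7 : (e.toOpenPartialHomeomorph.symm ∘ e) =ᶠ[nhds ξ] id := by
    filter_upwards [e.open_source.mem_nhds hξ] with ζ hζ
    exact e.toOpenPartialHomeomorph.left_inv hζ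
  rw [h7.mfderiv_eq, mfderiv_id] at h6
  have h8 := congrArg (fun L => L A) h6
  simp only [ContinuousLinearMap.comp_apply] at h8
  rw [h4, map_zero] at h8
  exact h8

theorem fibreCoord_eq_continuousLinearMapAt {x : M} {ζ : TangentBundle 𝓘(ℝ, E) M}
    (hζ : ζ.proj ∈ (chartAt E x).source) :
    fibreCoord x ζ = (trivializationAt E
      (TangentSpace 𝓘(ℝ, E) : M → Type _) x).continuousLinearMapAt ℝ ζ.proj ζ.snd :=
  ((trivializationAt E (TangentSpace 𝓘(ℝ, E) : M → Type _) x).continuousLinearMapAt_apply_of_mem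
    (R := ℝ) (b := ζ.proj) (by simpa using hζ) ζ.snd).symm

/-- The trivialization of the tangent bundle at `x` is the identity on `T_x M`, which is `E` by
definition. -/
theorem continuousLinearMapAt_trivializationAt_self (x : M) :
    (trivializationAt E (TangentSpace 𝓘(ℝ, E) : M → Type _) x).continuousLinearMapAt ℝ x
      = ContinuousLinearMap.id ℝ E := by
  rw [TangentBundle.continuousLinearMapAt_trivializationAt (mem_chart_source E x)]
  exact mfderiv_extChartAt_self

theorem symmL_trivializationAt_self (x : M) :
    (trivializationAt E (TangentSpace 𝓘(ℝ, E) : M → Type _) x).symmL ℝ x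
      = ContinuousLinearMap.id ℝ E := by
  ext v
  have h := (trivializationAt E (TangentSpace 𝓘(ℝ, E) : M → Type _) x).continuousLinearMapAt_symmL
    (R := ℝ) (FiberBundle.mem_baseSet_trivializationAt' x) v
  rw [continuousLinearMapAt_trivializationAt_self] at h
  exact h

theorem fibreCoord_self (ξ : TangentBundle 𝓘(ℝ, E) M) : fibreCoord ξ.proj ξ = ξ.snd := by
  rw [fibreCoord_eq_continuousLinearMapAt (mem_chart_source E _),
    continuousLinearMapAt_trivializationAt_self]
  rfl

variable {φ : M → N} (hφ : ContMDiff 𝓘(ℝ, E) 𝓘(ℝ, F) ∞ φ)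
include hφ

theorem mdifferentiableAt_tangentMap (ξ : TangentBundle 𝓘(ℝ, E) M) :
    MDifferentiableAt 𝓘(ℝ, E).tangent 𝓘(ℝ, F).tangent (tangentMap 𝓘(ℝ, E) 𝓘(ℝ, F) φ) ξ :=
  (hφ.contMDiff_tangentMap (m := 1) (by norm_cast)).contMDiffAt.mdifferentiableAt one_ne_zero

theorem projDeriv_mfderiv_tangentMap (ξ : TangentBundle 𝓘(ℝ, E) M)
    (A : TangentSpace 𝓘(ℝ, E).tangent ξ) :
    projDeriv (tangentMap 𝓘(ℝ, E) 𝓘(ℝ, F) φ ξ)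
        (mfderiv 𝓘(ℝ, E).tangent 𝓘(ℝ, F).tangent (tangentMap 𝓘(ℝ, E) 𝓘(ℝ, F) φ) ξ A)
      = mfderiv 𝓘(ℝ, E) 𝓘(ℝ, F) φ ξ.proj (projDeriv ξ A) := by
  have h1 := mfderiv_comp ξ (mdifferentiableAt_proj (tangentMap 𝓘(ℝ, E) 𝓘(ℝ, F) φ ξ))
    (mdifferentiableAt_tangentMap hφ ξ)
  have h2 := mfderiv_comp ξ (hφ.mdifferentiableAt (x := ξ.proj) (by simp))
    (mdifferentiableAt_proj ξ)
  have h3 := h1.symm.trans h2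
  exact congrArg (fun L => L A) h3

/-- The derivative of `Φ = φ_*` in the fibre coordinates, which is the derivative of
`(z, e) ↦ Dφ(z) e` with `φ` read in charts. -/
theorem mvfderiv_fibreCoord_mfderiv_tangentMap (ξ : TangentBundle 𝓘(ℝ, E) M)
    (A : TangentSpace 𝓘(ℝ, E).tangent ξ) :
    mvfderiv 𝓘(ℝ, F).tangent (fibreCoord (φ ξ.proj)) (tangentMap 𝓘(ℝ, E) 𝓘(ℝ, F) φ ξ)
        (mfderiv 𝓘(ℝ, E).tangent 𝓘(ℝ, F).tangent (tangentMap 𝓘(ℝ, E) 𝓘(ℝ, F) φ) ξ A)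
      = fderiv ℝ (fderiv ℝ (writtenInExtChartAt 𝓘(ℝ, E) 𝓘(ℝ, F) ξ.proj φ))
          (extChartAt 𝓘(ℝ, E) ξ.proj ξ.proj) (projDeriv ξ A) ξ.snd
        + fderiv ℝ (writtenInExtChartAt 𝓘(ℝ, E) 𝓘(ℝ, F) ξ.proj φ)
          (extChartAt 𝓘(ℝ, E) ξ.proj ξ.proj)
          (mvfderiv 𝓘(ℝ, E).tangent (fibreCoord ξ.proj) ξ A) := by
  set x := ξ.proj with hx
  set D := fderiv ℝ (writtenInExtChartAt 𝓘(ℝ, E) 𝓘(ℝ, F) x φ) with hD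
  have hDd : DifferentiableAt ℝ D (extChartAt 𝓘(ℝ, E) x x) :=
    ((contDiffAt_writtenInExtChartAt hφ (mem_chartDomain φ x)).fderiv_right
      (m := 1) (by norm_cast)).differentiableAt one_ne_zero
  have h1 := mfderiv_comp ξ (mdifferentiableAt_fibreCoord (tangentMap 𝓘(ℝ, E) 𝓘(ℝ, F) φ ξ))
    (mdifferentiableAt_tangentMap hφ ξ)
  have hch : MDifferentiableAt 𝓘(ℝ, E) 𝓘(ℝ, E) (extChartAt 𝓘(ℝ, E) x) ξ.proj :=
    mdifferentiableAt_extChartAt (mem_chart_source E x)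
  have h2 := hch.comp ξ (mdifferentiableAt_proj ξ)
  have hc := mdifferentiableAt_fibreCoord ξ
  have h2' : mfderiv 𝓘(ℝ, E).tangent 𝓘(ℝ, E) (extChartAt 𝓘(ℝ, E) x ∘ TotalSpace.proj) ξ A
      = projDeriv ξ A := by
    rw [mfderiv_comp ξ hch (mdifferentiableAt_proj ξ), ← hx, mfderiv_extChartAt_self]
    rfl
  have hG : HasFDerivAt (fun p : E × E => D p.1 p.2)
      ((D (extChartAt 𝓘(ℝ, E) x x)).comp (ContinuousLinearMap.snd ℝ E E)
        + ((fderiv ℝ D (extChartAt 𝓘(ℝ, E) x x)).comp (ContinuousLinearMap.fst ℝ E E)).flip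
          (fibreCoord x ξ)) (extChartAt 𝓘(ℝ, E) x x, fibreCoord x ξ) :=
    HasFDerivAt.clm_apply (c := fun p : E × E => D p.1) (u := fun p : E × E => p.2)
      (HasFDerivAt.comp (g := D) (f := Prod.fst) (extChartAt 𝓘(ℝ, E) x x, fibreCoord x ξ)
        hDd.hasFDerivAt hasFDerivAt_fst) hasFDerivAt_snd
  have h5 : (fibreCoord (φ x) ∘ tangentMap 𝓘(ℝ, E) 𝓘(ℝ, F) φ) =ᶠ[nhds ξ]
      (fun p : E × E => D p.1 p.2) ∘
        fun ζ => ((extChartAt 𝓘(ℝ, E) x ∘ TotalSpace.proj) ζ, fibreCoord x ζ) := by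
    have ho : IsOpen (TotalSpace.proj ⁻¹' chartDomain (E := E) (F := F) φ x :
        Set (TangentBundle 𝓘(ℝ, E) M)) :=
      (isOpen_chartDomain hφ.continuous x).preimage (FiberBundle.continuous_proj E _)
    filter_upwards [ho.mem_nhds (mem_chartDomain φ x)] with ζ hζ
    simp only [Function.comp_apply]
    rw [fibreCoord_eq_continuousLinearMapAt hζ.1, fibreCoord_eq_continuousLinearMapAt hζ.2]
    exact continuousLinearMapAt_mfderiv hφ hζ ζ.snd
  have h6 : HasMFDerivAt 𝓘(ℝ, E).tangent 𝓘(ℝ, E × E)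
      (fun ζ => ((extChartAt 𝓘(ℝ, E) x ∘ TotalSpace.proj) ζ, fibreCoord x ζ)) ξ
      (ContinuousLinearMap.prod (mfderiv 𝓘(ℝ, E).tangent 𝓘(ℝ, E)
        (extChartAt 𝓘(ℝ, E) x ∘ TotalSpace.proj) ξ)
        (mfderiv 𝓘(ℝ, E).tangent 𝓘(ℝ, E) (fibreCoord x) ξ)) :=
    ⟨h2.hasMFDerivAt.1.prodMk hc.hasMFDerivAt.1, h2.hasMFDerivAt.2.prodMk hc.hasMFDerivAt.2⟩
  have h7 := (HasMFDerivAt.comp ξ hG.hasMFDerivAt h6).congr_of_eventuallyEq h5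
  have h9 := congrArg (fun L => L A) (h1.symm.trans h7.mfderiv)
  refine h9.trans ?_
  rw [← fibreCoord_self ξ]
  refine (add_comm _ _).trans ?_
  exact congrArg₂ (· + ·)
    (congrArg (fun v => fderiv ℝ D (extChartAt 𝓘(ℝ, E) x x) v (fibreCoord x ξ)) h2') rfl

end TangentMap

/-! ### Lifts, and the fibre coordinate of the complete lift of a vector field -/

section CompleteLift

variable {E : Type*} [NormedAddCommGroup E] [NormedSpace ℝ E]
  {M : Type*} [TopologicalSpace M] [ChartedSpace E M] [IsManifold 𝓘(ℝ, E) ∞ M]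

/-- The pullback of a vector field to the chart at `x`, on which the Lie bracket is defined, is its
fibre coordinate. -/
theorem mpullbackWithin_extChartAt_symm_eq {x : M} (V : Π x : M, TangentSpace 𝓘(ℝ, E) x) {z : E}
    (hz : z ∈ (extChartAt 𝓘(ℝ, E) x).target) :
    mpullbackWithin 𝓘(ℝ, E) 𝓘(ℝ, E) (extChartAt 𝓘(ℝ, E) x).symm V (Set.range 𝓘(ℝ, E)) z
      = fibreCoord x ⟨(extChartAt 𝓘(ℝ, E) x).symm z, V ((extChartAt 𝓘(ℝ, E) x).symm z)⟩ := by
  set y := (extChartAt 𝓘(ℝ, E) x).symm z with hy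
  have hys : y ∈ (chartAt E x).source := by
    rw [← extChartAt_source 𝓘(ℝ, E)]
    exact (extChartAt 𝓘(ℝ, E) x).map_target hz
  have hzy : z = extChartAt 𝓘(ℝ, E) x y := ((extChartAt 𝓘(ℝ, E) x).right_inv hz).symm
  have hyb : y ∈ (trivializationAt E (TangentSpace 𝓘(ℝ, E) : M → Type _) x).baseSet := by
    simpa using hys
  have h := TangentBundle.symmL_trivializationAt (I := 𝓘(ℝ, E)) hys
  rw [← hzy] at h
  have h2 : (mfderivWithin 𝓘(ℝ, E) 𝓘(ℝ, E) (extChartAt 𝓘(ℝ, E) x).symm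
      (Set.range 𝓘(ℝ, E)) z).inverse
      = (trivializationAt E (TangentSpace 𝓘(ℝ, E) : M → Type _) x).continuousLinearMapAt ℝ y := by
    rw [← h]
    refine ContinuousLinearMap.inverse_eq ?_ ?_
    · ext v
      exact Trivialization.symmL_continuousLinearMapAt _ hyb v
    · ext v
      exact Trivialization.continuousLinearMapAt_symmL _ hyb v
  rw [fibreCoord_eq_continuousLinearMapAt (ζ := ⟨y, V y⟩) hys, mpullbackWithin_apply, h2]
  rfl

/-- A vector field with constant fibre coordinate is constant in the chart, so its bracket with `η`
is a directional derivative of the fibre coordinate of `η`. -/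
theorem mlieBracket_constSection (ξ : TangentBundle 𝓘(ℝ, E) M)
    {η : Π x : M, TangentSpace 𝓘(ℝ, E) x} (hη : MDiffAt (T% η) ξ.proj) :
    mlieBracket 𝓘(ℝ, E) (constSection ξ) η ξ.proj
      = (trivializationAt E (TangentSpace 𝓘(ℝ, E) : M → Type _) ξ.proj).symmL ℝ ξ.proj
        (mvfderiv 𝓘(ℝ, E) (fun y => fibreCoord ξ.proj ⟨y, η y⟩) ξ.proj ξ.snd) := by
  set x := ξ.proj with hx
  have hc : MDifferentiableAt 𝓘(ℝ, E) 𝓘(ℝ, E) (fun y => fibreCoord x ⟨y, η y⟩) x :=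
    MDifferentiableAt.comp (f := fun y => (⟨y, η y⟩ : TangentBundle 𝓘(ℝ, E) M)) (g := fibreCoord x)
      x (mdifferentiableAt_fibreCoord (⟨x, η x⟩ : TangentBundle 𝓘(ℝ, E) M)) hη
  have ht : (extChartAt 𝓘(ℝ, E) x).target ∈ nhds (extChartAt 𝓘(ℝ, E) x x) :=
    extChartAt_target_mem_nhds x
  have h1 : mpullbackWithin 𝓘(ℝ, E) 𝓘(ℝ, E) (extChartAt 𝓘(ℝ, E) x).symm (constSection ξ)
      (Set.range 𝓘(ℝ, E)) =ᶠ[nhds (extChartAt 𝓘(ℝ, E) x x)] fun _ => ξ.snd := by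
    filter_upwards [ht] with z hz
    rw [mpullbackWithin_extChartAt_symm_eq _ hz]
    have hb : (extChartAt 𝓘(ℝ, E) x).symm z ∈
        (trivializationAt E (TangentSpace 𝓘(ℝ, E) : M → Type _) x).baseSet := by
      simpa using (extChartAt 𝓘(ℝ, E) x).map_target hz
    rw [fibreCoord, constSection, Trivialization.apply_mk_symm _ hb, fibreCoord_self]
  have h2 : mpullbackWithin 𝓘(ℝ, E) 𝓘(ℝ, E) (extChartAt 𝓘(ℝ, E) x).symm η
      (Set.range 𝓘(ℝ, E)) =ᶠ[nhds (extChartAt 𝓘(ℝ, E) x x)]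
      fun z => fibreCoord x ⟨(extChartAt 𝓘(ℝ, E) x).symm z, η ((extChartAt 𝓘(ℝ, E) x).symm z)⟩ := by
    filter_upwards [ht] with z hz
    exact mpullbackWithin_extChartAt_symm_eq _ hz
  have h3 : ∀ (V W : E → E) (e : E), V =ᶠ[nhds (extChartAt 𝓘(ℝ, E) x x)] (fun _ => e) →
      W =ᶠ[nhds (extChartAt 𝓘(ℝ, E) x x)] (fun z => fibreCoord x
        ⟨(extChartAt 𝓘(ℝ, E) x).symm z, η ((extChartAt 𝓘(ℝ, E) x).symm z)⟩) →
      lieBracketWithin ℝ V W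
      ((extChartAt 𝓘(ℝ, E) x).symm ⁻¹' Set.univ ∩ Set.range 𝓘(ℝ, E)) (extChartAt 𝓘(ℝ, E) x x)
      = mvfderiv 𝓘(ℝ, E) (fun y => fibreCoord x ⟨y, η y⟩) x e := by
    intro V W e hV hW
    have h4 : (extChartAt 𝓘(ℝ, E) x).symm ⁻¹' Set.univ ∩ Set.range 𝓘(ℝ, E) = Set.univ := by simp
    have h5 : mvfderiv 𝓘(ℝ, E) (fun y => fibreCoord x ⟨y, η y⟩) x e
        = fderiv ℝ (fun z => fibreCoord x
          ⟨(extChartAt 𝓘(ℝ, E) x).symm z, η ((extChartAt 𝓘(ℝ, E) x).symm z)⟩)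
          (extChartAt 𝓘(ℝ, E) x x) e := by
      rw [mvfderiv, hc.mfderiv, modelWithCornersSelf_coe, Set.range_id, fderivWithin_univ]
      rfl
    rw [h4, lieBracketWithin_univ]
    rw [lieBracket, hV.fderiv_eq, hW.fderiv_eq, hV.self_of_nhds, h5]
    simp
  have h6 : (mfderiv 𝓘(ℝ, E) 𝓘(ℝ, E) (extChartAt 𝓘(ℝ, E) x) x).inverse
      = ContinuousLinearMap.id ℝ E := by
    rw [mfderiv_extChartAt_self]
    exact ContinuousLinearMap.inverse_id
  rw [← mlieBracketWithin_univ, mlieBracketWithin_apply, symmL_trivializationAt_self]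
  exact congrArg₂ (fun (L : E →L[ℝ] E) v => L v) h6 (h3 _ _ _ h1 h2)

theorem mdifferentiableAt_constSection (ξ : TangentBundle 𝓘(ℝ, E) M) :
    MDiffAt (T% (constSection ξ)) ξ.proj :=
  mdifferentiableAt_extend 𝓘(ℝ, E) E (ξ.snd : TangentSpace 𝓘(ℝ, E) ξ.proj)

variable [RiemannianBundle (fun x : M => TangentSpace 𝓘(ℝ, E) x)]
  [IsContMDiffRiemannianBundle 𝓘(ℝ, E) ∞ E (fun x : M => TangentSpace 𝓘(ℝ, E) x)]
  [FiniteDimensional ℝ E]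

@[simp]
theorem projDeriv_horizontalLift (ξ : TangentBundle 𝓘(ℝ, E) M) (X : TangentSpace 𝓘(ℝ, E) ξ.proj) :
    projDeriv ξ (horizontalLift ξ X) = X :=
  congrArg Prod.fst ((splitting ξ).apply_symm_apply (X, 0))

@[simp]
theorem connectionMap_horizontalLift (ξ : TangentBundle 𝓘(ℝ, E) M)
    (X : TangentSpace 𝓘(ℝ, E) ξ.proj) : connectionMap ξ (horizontalLift ξ X) = 0 :=
  congrArg Prod.snd ((splitting ξ).apply_symm_apply (X, 0))

@[simp]
theorem projDeriv_verticalLift (ξ : TangentBundle 𝓘(ℝ, E) M) (X : TangentSpace 𝓘(ℝ, E) ξ.proj) :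
    projDeriv ξ (verticalLift ξ X) = 0 :=
  congrArg Prod.fst ((splitting ξ).apply_symm_apply (0, X))

@[simp]
theorem connectionMap_verticalLift (ξ : TangentBundle 𝓘(ℝ, E) M)
    (X : TangentSpace 𝓘(ℝ, E) ξ.proj) : connectionMap ξ (verticalLift ξ X) = X :=
  congrArg Prod.snd ((splitting ξ).apply_symm_apply (0, X))

theorem ext_projDeriv_connectionMap {ξ : TangentBundle 𝓘(ℝ, E) M}
    {A B : TangentSpace 𝓘(ℝ, E).tangent ξ} (h1 : projDeriv ξ A = projDeriv ξ B)
    (h2 : connectionMap ξ A = connectionMap ξ B) : A = B :=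
  (splitting ξ).injective (Prod.ext h1 h2)

/-- The vector `η^h + (∇_ξ η)^v` is the complete lift of `η` at `ξ`: its fibre coordinate is the
derivative along `ξ` of the fibre coordinate of `η`, whatever the metric. As `∇` is torsion-free,
the Christoffel term of the connection map cancels against the one of `∇_ξ η`. -/
theorem mvfderiv_fibreCoord_completeLift (ξ : TangentBundle 𝓘(ℝ, E) M)
    {η : Π x : M, TangentSpace 𝓘(ℝ, E) x} (hη : MDiffAt (T% η) ξ.proj) :
    mvfderiv 𝓘(ℝ, E).tangent (fibreCoord ξ.proj) ξ (horizontalLift ξ (η ξ.proj)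
        + verticalLift ξ (leviCivita E M η ξ.proj ξ.snd))
      = mvfderiv 𝓘(ℝ, E) (fun y => fibreCoord ξ.proj ⟨y, η y⟩) ξ.proj ξ.snd := by
  set A := horizontalLift ξ (η ξ.proj) + verticalLift ξ (leviCivita E M η ξ.proj ξ.snd) with hA
  have hpA : projDeriv ξ A = η ξ.proj := by
    rw [hA, map_add, projDeriv_horizontalLift, projDeriv_verticalLift, add_zero]
  have hKA : connectionMap ξ A = leviCivita E M η ξ.proj ξ.snd := by
    rw [hA, map_add, connectionMap_horizontalLift, connectionMap_verticalLift, zero_add]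
  have hx := FiberBundle.mem_baseSet_trivializationAt' (F := E)
    (E := (TangentSpace 𝓘(ℝ, E) : M → Type _)) ξ.proj
  have h2 := (CovariantDerivative.torsion_eq_zero_iff _).1 (leviCivita_torsion (E := E) (M := M))
    (mdifferentiableAt_constSection ξ) hη
  have h3 : constSection ξ ξ.proj = ξ.snd :=
    Trivialization.symm_apply_apply_mk _ hx ξ.snd
  rw [connectionMap, _root_.add_apply, ContinuousLinearMap.comp_apply,
    ContinuousLinearMap.comp_apply, hpA] at hKA
  rw [mlieBracket_constSection ξ hη, h3, ← hKA, add_sub_cancel_right] at h2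
  have h4 := congrArg ((trivializationAt E (TangentSpace 𝓘(ℝ, E) : M → Type _)
    ξ.proj).continuousLinearMapAt ℝ ξ.proj) h2
  rwa [Trivialization.continuousLinearMapAt_symmL _ hx,
    Trivialization.continuousLinearMapAt_symmL _ hx] at h4

end CompleteLift

/-! ### The vertical space of the tangent map -/

section VerticalTangent

variable {E : Type*} [NormedAddCommGroup E] [NormedSpace ℝ E]
  {M : Type*} [TopologicalSpace M] [ChartedSpace E M] [IsManifold 𝓘(ℝ, E) ∞ M]
  {F : Type*} [NormedAddCommGroup F] [NormedSpace ℝ F]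
  {N : Type*} [TopologicalSpace N] [ChartedSpace F N] [IsManifold 𝓘(ℝ, F) ∞ N]
  {φ : M → N}

theorem mem_verticalSpaceTangent_iff {ξ : TangentBundle 𝓘(ℝ, E) M}
    {A : TangentSpace 𝓘(ℝ, E).tangent ξ} :
    A ∈ verticalSpaceTangent (F := F) φ ξ ↔
      mfderiv 𝓘(ℝ, E).tangent 𝓘(ℝ, F).tangent (tangentMap 𝓘(ℝ, E) 𝓘(ℝ, F) φ) ξ A = 0 :=
  Iff.rfl

omit [IsManifold 𝓘(ℝ, E) ∞ M] [IsManifold 𝓘(ℝ, F) ∞ N] in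
theorem mem_verticalSpace_iff {x : M} {v : TangentSpace 𝓘(ℝ, E) x} :
    v ∈ verticalSpace 𝓘(ℝ, E) 𝓘(ℝ, F) φ x ↔ mfderiv 𝓘(ℝ, E) 𝓘(ℝ, F) φ x v = 0 :=
  Iff.rfl

theorem projDeriv_mem_verticalSpace (hφ : ContMDiff 𝓘(ℝ, E) 𝓘(ℝ, F) ∞ φ)
    {ξ : TangentBundle 𝓘(ℝ, E) M}
    {A : TangentSpace 𝓘(ℝ, E).tangent ξ} (hA : A ∈ verticalSpaceTangent (F := F) φ ξ) :
    projDeriv ξ A ∈ verticalSpace 𝓘(ℝ, E) 𝓘(ℝ, F) φ ξ.proj := by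
  rw [mem_verticalSpaceTangent_iff] at hA
  rw [mem_verticalSpace_iff, ← projDeriv_mfderiv_tangentMap hφ, hA, map_zero]
  rfl

variable [FiniteDimensional ℝ E]
  [RiemannianBundle (fun x : M => TangentSpace 𝓘(ℝ, E) x)]
  [IsContMDiffRiemannianBundle 𝓘(ℝ, E) ∞ E (fun x : M => TangentSpace 𝓘(ℝ, E) x)]
  (hφ : ContMDiff 𝓘(ℝ, E) 𝓘(ℝ, F) ∞ φ)
include hφ

/-- The complete lift of a vertical field is vertical for `φ_*`: in coordinates, `φ_*` takes it to
`D²φ(η, ξ) + Dφ(∂_ξ η)`, which by the symmetry of `D²φ` is the derivative of `Dφ(η) = 0` along `ξ`. -/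
theorem completeLift_mem_verticalSpaceTangent (ξ : TangentBundle 𝓘(ℝ, E) M)
    {η : Π x : M, TangentSpace 𝓘(ℝ, E) x} (hη : IsVerticalField (F := F) φ η) :
    horizontalLift ξ (η ξ.proj) + verticalLift ξ (leviCivita E M η ξ.proj ξ.snd)
      ∈ verticalSpaceTangent (F := F) φ ξ := by
  have hηd : MDiffAt (T% η) ξ.proj := hη.contMDiff.mdifferentiableAt (by simp)
  rw [mem_verticalSpaceTangent_iff]
  refine eq_zero_of_projDeriv_of_fibreCoord ?_ ?_
  · rw [projDeriv_mfderiv_tangentMap hφ, map_add, projDeriv_horizontalLift, projDeriv_verticalLift,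
      add_zero]
    exact hη.vertical ξ.proj
  · refine (mvfderiv_fibreCoord_mfderiv_tangentMap hφ ξ _).trans ?_
    rw [mvfderiv_fibreCoord_completeLift ξ hηd, map_add, projDeriv_horizontalLift,
      projDeriv_verticalLift, add_zero]
    set x := ξ.proj with hx
    have hsymm : IsSymmSndFDerivAt ℝ (writtenInExtChartAt 𝓘(ℝ, E) 𝓘(ℝ, F) x φ)
        (extChartAt 𝓘(ℝ, E) x x) :=
      (contDiffAt_writtenInExtChartAt hφ (mem_chartDomain φ x)).isSymmSndFDerivAt (by
        rw [minSmoothness_of_isRCLikeNormedField]; exact ENat.LEInfty.out)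
    -- Differentiating `φ_* η = 0` along `ξ` gives the same expression with the arguments of the
    -- second derivative exchanged.
    have hp : MDifferentiableAt 𝓘(ℝ, E).tangent 𝓘(ℝ, E)
      (TotalSpace.proj : TangentBundle 𝓘(ℝ, E) M → M) ⟨x, η x⟩ := mdifferentiableAt_proj _
    have h1 := mvfderiv_fibreCoord_mfderiv_tangentMap hφ (⟨x, η x⟩ : TangentBundle 𝓘(ℝ, E) M)
      (mfderiv 𝓘(ℝ, E) 𝓘(ℝ, E).tangent
          (fun y => (⟨y, η y⟩ : TangentBundle 𝓘(ℝ, E) M)) x ξ.snd)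
    have h2 : projDeriv (⟨x, η x⟩ : TangentBundle 𝓘(ℝ, E) M) (mfderiv 𝓘(ℝ, E) 𝓘(ℝ, E).tangent
          (fun y => (⟨y, η y⟩ : TangentBundle 𝓘(ℝ, E) M)) x ξ.snd) = ξ.snd := by
      have := mfderiv_comp x hp hηd
      have h2 : ((TotalSpace.proj : TangentBundle 𝓘(ℝ, E) M → M) ∘
        (fun y => (⟨y, η y⟩ : TangentBundle 𝓘(ℝ, E) M))) = id := rfl
      rw [h2, mfderiv_id] at this
      exact (congrArg (fun L => L ξ.snd) this).symm
    have h3 : mvfderiv 𝓘(ℝ, E).tangent (fibreCoord x) (⟨x, η x⟩ : TangentBundle 𝓘(ℝ, E) M)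
        (mfderiv 𝓘(ℝ, E) 𝓘(ℝ, E).tangent
          (fun y => (⟨y, η y⟩ : TangentBundle 𝓘(ℝ, E) M)) x ξ.snd)
        = mvfderiv 𝓘(ℝ, E) (fun y => fibreCoord x ⟨y, η y⟩) x ξ.snd := by
      have := mfderiv_comp x
        (mdifferentiableAt_fibreCoord (⟨x, η x⟩ : TangentBundle 𝓘(ℝ, E) M)) hηd
      exact (congrArg (fun L => L ξ.snd) this).symm
    have h4 : mvfderiv 𝓘(ℝ, F).tangent (fibreCoord (φ x))
        (tangentMap 𝓘(ℝ, E) 𝓘(ℝ, F) φ (⟨x, η x⟩ : TangentBundle 𝓘(ℝ, E) M))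
        (mfderiv 𝓘(ℝ, E).tangent 𝓘(ℝ, F).tangent (tangentMap 𝓘(ℝ, E) 𝓘(ℝ, F) φ)
          (⟨x, η x⟩ : TangentBundle 𝓘(ℝ, E) M)
          (mfderiv 𝓘(ℝ, E) 𝓘(ℝ, E).tangent
            (fun y => (⟨y, η y⟩ : TangentBundle 𝓘(ℝ, E) M)) x ξ.snd)) = 0 := by
      have h5 : (fun y => fibreCoord (φ x) (tangentMap 𝓘(ℝ, E) 𝓘(ℝ, F) φ
          (⟨y, η y⟩ : TangentBundle 𝓘(ℝ, E) M))) =ᶠ[nhds x] fun _ => (0 : F) := by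
        filter_upwards [(isOpen_chartDomain (E := E) (F := F) hφ.continuous x).mem_nhds
            (mem_chartDomain φ x)]
          with y hy
        rw [fibreCoord_eq_continuousLinearMapAt (E := F) (x := φ x) (ζ := tangentMap 𝓘(ℝ, E) 𝓘(ℝ, F) φ
          (⟨y, η y⟩ : TangentBundle 𝓘(ℝ, E) M)) hy.2]
        have : (tangentMap 𝓘(ℝ, E) 𝓘(ℝ, F) φ (⟨y, η y⟩ : TangentBundle 𝓘(ℝ, E) M)).snd = 0 :=
          hη.vertical y
        rw [this, map_zero]
      have h6 := mfderiv_comp x ((mdifferentiableAt_fibreCoord (tangentMap 𝓘(ℝ, E) 𝓘(ℝ, F) φ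
          (⟨x, η x⟩ : TangentBundle 𝓘(ℝ, E) M))).comp (⟨x, η x⟩ : TangentBundle 𝓘(ℝ, E) M)
          (mdifferentiableAt_tangentMap hφ _)) hηd
      have h7 := mfderiv_comp (⟨x, η x⟩ : TangentBundle 𝓘(ℝ, E) M)
          (mdifferentiableAt_fibreCoord (tangentMap 𝓘(ℝ, E) 𝓘(ℝ, F) φ
          (⟨x, η x⟩ : TangentBundle 𝓘(ℝ, E) M)))
          (mdifferentiableAt_tangentMap hφ _)
      rw [h7] at h6
      have h8 := congrArg (fun L => L ξ.snd) (h6.symm.trans h5.mfderiv_eq)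
      rw [mfderiv_const] at h8
      exact h8
    have h9 : fderiv ℝ (fderiv ℝ (writtenInExtChartAt 𝓘(ℝ, E) 𝓘(ℝ, F) x φ))
          (extChartAt 𝓘(ℝ, E) x x) ξ.snd (η x)
        + fderiv ℝ (writtenInExtChartAt 𝓘(ℝ, E) 𝓘(ℝ, F) x φ) (extChartAt 𝓘(ℝ, E) x x)
          (mvfderiv 𝓘(ℝ, E) (fun y => fibreCoord x ⟨y, η y⟩) x ξ.snd) = 0 := by
      rw [← h3]
      refine Eq.trans ?_ (h1.symm.trans h4)
      exact congrArg (fun v => fderiv ℝ (fderiv ℝ (writtenInExtChartAt 𝓘(ℝ, E) 𝓘(ℝ, F) x φ))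
          (extChartAt 𝓘(ℝ, E) x x) v (η x) + _) h2.symm
    exact (congrArg (· + _) (hsymm (η x) ξ.snd)).trans h9

/-- A vector of `T_ξ TM` that is tangent to the fibre of `TM` and vertical for `φ_*` is the vertical
lift of a vector that is vertical for `φ`. -/
theorem connectionMap_mem_verticalSpace {ξ : TangentBundle 𝓘(ℝ, E) M}
    {A : TangentSpace 𝓘(ℝ, E).tangent ξ} (hA : A ∈ verticalSpaceTangent (F := F) φ ξ)
    (h0 : projDeriv ξ A = 0) :
    connectionMap ξ A ∈ verticalSpace 𝓘(ℝ, E) 𝓘(ℝ, F) φ ξ.proj := by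
  rw [mem_verticalSpaceTangent_iff] at hA
  have h1 := mvfderiv_fibreCoord_mfderiv_tangentMap hφ ξ A
  rw [hA, map_zero, h0] at h1
  have h2 := continuousLinearMapAt_mfderiv hφ (mem_chartDomain φ ξ.proj) (connectionMap ξ A)
  rw [connectionMap, _root_.add_apply, ContinuousLinearMap.comp_apply,
    ContinuousLinearMap.comp_apply, h0, map_zero, add_zero,
    Trivialization.continuousLinearMapAt_symmL _ (FiberBundle.mem_baseSet_trivializationAt' _)] at h2
  rw [mem_verticalSpace_iff, connectionMap, _root_.add_apply, ContinuousLinearMap.comp_apply,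
    ContinuousLinearMap.comp_apply, h0, map_zero, add_zero]
  have h3 : (0 : F) = 0 + _ := h1.trans (congrArg (· + _) (congrArg (fun L : E →L[ℝ] F => L ξ.snd)
    (fderiv ℝ (fderiv ℝ (writtenInExtChartAt 𝓘(ℝ, E) 𝓘(ℝ, F) ξ.proj φ))
      (extChartAt 𝓘(ℝ, E) ξ.proj ξ.proj)).map_zero))
  rw [zero_add] at h3
  rw [← h3] at h2
  have h4 := congrArg ((trivializationAt F (TangentSpace 𝓘(ℝ, F) : N → Type _)
    (φ ξ.proj)).symmL ℝ (φ ξ.proj)) h2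
  rwa [Trivialization.symmL_continuousLinearMapAt _ (FiberBundle.mem_baseSet_trivializationAt' _),
    map_zero] at h4

end VerticalTangent

/-! ### Extending vertical vectors to vertical fields -/

section Extension

variable {E : Type*} [NormedAddCommGroup E] [NormedSpace ℝ E]
  {M : Type*} [TopologicalSpace M] [ChartedSpace E M] [IsManifold 𝓘(ℝ, E) ∞ M]

theorem contMDiffOn_symmL {x : M} {v : E → E} {U : Set M} (hU : U ⊆ (chartAt E x).source)
    (hv : ∀ y ∈ U, ContDiffAt ℝ ∞ v (extChartAt 𝓘(ℝ, E) x y)) :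
    ContMDiffOn 𝓘(ℝ, E) 𝓘(ℝ, E).tangent ∞
      (fun y => (⟨y, (trivializationAt E (TangentSpace 𝓘(ℝ, E) : M → Type _) x).symmL ℝ y
        (v (extChartAt 𝓘(ℝ, E) x y))⟩ : TangentBundle 𝓘(ℝ, E) M)) U := by
  intro y hy
  have hyb : y ∈ (trivializationAt E (TangentSpace 𝓘(ℝ, E) : M → Type _) x).baseSet := by
    simpa using hU hy
  refine ContMDiffAt.contMDiffWithinAt ?_
  rw [Trivialization.contMDiffAt_section_iff (IB := 𝓘(ℝ, E))
    (trivializationAt E (TangentSpace 𝓘(ℝ, E) : M → Type _) x) hyb]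
  have h1 : ContMDiffAt 𝓘(ℝ, E) 𝓘(ℝ, E) ∞ (v ∘ extChartAt 𝓘(ℝ, E) x) y :=
    (hv y hy).contMDiffAt.comp y (contMDiffAt_extChartAt' (hU hy))
  refine h1.congr_of_eventuallyEq ?_
  filter_upwards [(Trivialization.open_baseSet _).mem_nhds hyb] with z hz
  simp only [Trivialization.symmL_apply _ hz, Trivialization.apply_mk_symm _ hz]
  rfl


variable {F : Type*} [NormedAddCommGroup F] [NormedSpace ℝ F]
  {N : Type*} [TopologicalSpace N] [ChartedSpace F N]
  {φ : M → N}

theorem IsVerticalField.smul {f : M → ℝ} (hf : ContMDiff 𝓘(ℝ, E) 𝓘(ℝ) ∞ f)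
    {η : Π x : M, TangentSpace 𝓘(ℝ, E) x} (hη : IsVerticalField (F := F) φ η) :
    IsVerticalField (F := F) φ (f • η) :=
  ⟨hf.smul_section hη.contMDiff, fun x => Submodule.smul_mem _ _ (hη.vertical x)⟩

variable [IsManifold 𝓘(ℝ, F) ∞ N]

theorem mem_verticalSpace_iff_fderiv (hφ : ContMDiff 𝓘(ℝ, E) 𝓘(ℝ, F) ∞ φ) {x y : M}
    (hy : y ∈ chartDomain (E := E) (F := F) φ x) {w : TangentSpace 𝓘(ℝ, E) y} :
    w ∈ verticalSpace 𝓘(ℝ, E) 𝓘(ℝ, F) φ y ↔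
      fderiv ℝ (writtenInExtChartAt 𝓘(ℝ, E) 𝓘(ℝ, F) x φ) (extChartAt 𝓘(ℝ, E) x y)
        ((trivializationAt E (TangentSpace 𝓘(ℝ, E) : M → Type _) x).continuousLinearMapAt ℝ y w)
        = 0 := by
  have hyb' : φ y ∈ (trivializationAt F (TangentSpace 𝓘(ℝ, F) : N → Type _) (φ x)).baseSet := by
    simpa using hy.2
  rw [← continuousLinearMapAt_mfderiv hφ hy, mem_verticalSpace_iff]
  refine ⟨fun h => by rw [h, map_zero], fun h => ?_⟩
  have h1 := congrArg
    ((trivializationAt F (TangentSpace 𝓘(ℝ, F) : N → Type _) (φ x)).symmL ℝ (φ y)) h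
  rwa [Trivialization.symmL_continuousLinearMapAt _ hyb', map_zero] at h1

theorem fderiv_writtenInExtChartAt_surjective (hφ : IsSmoothSubmersion 𝓘(ℝ, E) 𝓘(ℝ, F) φ) (x : M) :
    Function.Surjective (fderiv ℝ (writtenInExtChartAt 𝓘(ℝ, E) 𝓘(ℝ, F) x φ)
      (extChartAt 𝓘(ℝ, E) x x)) := by
  intro f
  obtain ⟨w, hw⟩ := hφ.surjective_mfderiv x ((trivializationAt F (TangentSpace 𝓘(ℝ, F) : N → Type _)
    (φ x)).symmL ℝ (φ x) f)
  refine ⟨(trivializationAt E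
    (TangentSpace 𝓘(ℝ, E) : M → Type _) x).continuousLinearMapAt ℝ x w, ?_⟩
  rw [← continuousLinearMapAt_mfderiv hφ.contMDiff (mem_chartDomain φ x), hw,
    Trivialization.continuousLinearMapAt_symmL _ (FiberBundle.mem_baseSet_trivializationAt' _)]

variable [FiniteDimensional ℝ E] [T2Space M]

theorem exists_contMDiff_cutoff {x : M} {U : Set M} (hU : U ∈ nhds x) :
    ∃ ψ : M → ℝ, ContMDiff 𝓘(ℝ, E) 𝓘(ℝ) ∞ ψ ∧ ψ x = 1 ∧ tsupport ψ ⊆ U := by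
  obtain ⟨f, -, hf⟩ := (SmoothBumpFunction.nhds_basis_tsupport (I := 𝓘(ℝ, E)) x).mem_iff.1 hU
  exact ⟨f, f.contMDiff, f.eq_one, hf⟩

/-- Multiplying a vector field `Y` by such a function gives a field that vanishes at `x` and whose
covariant derivative along `v` is `Y x`. -/
theorem exists_contMDiff_eq_zero_mvfderiv_eq_one {x : M} {v : TangentSpace 𝓘(ℝ, E) x}
    (hv : v ≠ 0) :
    ∃ f : M → ℝ, ContMDiff 𝓘(ℝ, E) 𝓘(ℝ) ∞ f ∧ f x = 0 ∧ mvfderiv 𝓘(ℝ, E) f x v = 1 := by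
  obtain ⟨l, hl⟩ : ∃ l : E →L[ℝ] ℝ, l v = 1 :=
    SeparatingDual.exists_eq_one (R := ℝ) (V := E) (x := (v : E)) hv
  obtain ⟨ψ⟩ : Nonempty (SmoothBumpFunction 𝓘(ℝ, E) x) := inferInstance
  let g : M → ℝ := fun y => l (extChartAt 𝓘(ℝ, E) x y - extChartAt 𝓘(ℝ, E) x x)
  have hg : ContMDiffOn 𝓘(ℝ, E) 𝓘(ℝ) ∞ g (chartAt E x).source :=
    l.contMDiff.comp_contMDiffOn (contMDiffOn_extChartAt.sub contMDiffOn_const)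
  refine ⟨fun y => ψ y • g y, ψ.contMDiff_smul hg, by simp [g], ?_⟩
  have h1 : (fun y => ψ y • g y) =ᶠ[nhds x] g := by
    filter_upwards [ψ.eventuallyEq_one] with y hy
    simp [hy]
  have h2 : HasMFDerivAt 𝓘(ℝ, E) 𝓘(ℝ) g x (l.comp (ContinuousLinearMap.id ℝ E)) := by
    have h3 : HasFDerivAt (fun e : E => l (e - extChartAt 𝓘(ℝ, E) x x)) l
        (extChartAt 𝓘(ℝ, E) x x) := l.hasFDerivAt.comp _ ((hasFDerivAt_id _).sub_const _)
    have h4 := (mdifferentiableAt_extChartAt (I := 𝓘(ℝ, E)) (mem_chart_source E x)).hasMFDerivAt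
    rw [mfderiv_extChartAt_self] at h4
    exact h3.hasMFDerivAt.comp x h4
  have h3 := (h2.congr_of_eventuallyEq h1).mfderiv
  rw [mvfderiv, h3]
  exact hl

/-- A smooth section over an open set `U` of a family `S` of subspaces can be changed, away from a
given point of `U`, into a global one. -/
theorem exists_contMDiff_section_of_local (S : Π y : M, Submodule ℝ (TangentSpace 𝓘(ℝ, E) y))
    {x : M} {U : Set M} (hU : IsOpen U) (hx : x ∈ U) {V : Π x : M, TangentSpace 𝓘(ℝ, E) x}
    (hV : ContMDiffOn 𝓘(ℝ, E) 𝓘(ℝ, E).tangent ∞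
      (fun y => (⟨y, V y⟩ : TangentBundle 𝓘(ℝ, E) M)) U) (hV' : ∀ y ∈ U, V y ∈ S y) :
    ∃ W : Π x : M, TangentSpace 𝓘(ℝ, E) x, ContMDiff 𝓘(ℝ, E) 𝓘(ℝ, E).tangent ∞
      (fun y => (⟨y, W y⟩ : TangentBundle 𝓘(ℝ, E) M)) ∧ (∀ y, W y ∈ S y) ∧ W x = V x := by
  obtain ⟨ψ, hψ, hψx, hψU⟩ := exists_contMDiff_cutoff (E := E) (hU.mem_nhds hx)
  refine ⟨ψ • V, hψ.contMDiffOn.smul_section_of_tsupport hU hψU hV, fun y => ?_, ?_⟩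
  · by_cases hy : y ∈ U
    · exact Submodule.smul_mem _ _ (hV' y hy)
    · rw [Pi.smul_apply', image_eq_zero_of_notMem_tsupport (fun h => hy (hψU h)), zero_smul]
      exact Submodule.zero_mem _
  · rw [Pi.smul_apply', hψx, one_smul]

variable [FiniteDimensional ℝ F]

/-- A vector tangent to the fibre of a submersion extends to a vertical field. In a chart, `D` being
the derivative of `φ` and `R` a right inverse of `D` at `x`, the field is the image of a fixed vector
under the projection `1 - R (D R)⁻¹ D` onto `ker D`, defined where `D R` is invertible. -/
theorem exists_isVerticalField (hφ : IsSmoothSubmersion 𝓘(ℝ, E) 𝓘(ℝ, F) φ) {x : M}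
    {v : TangentSpace 𝓘(ℝ, E) x} (hv : v ∈ verticalSpace 𝓘(ℝ, E) 𝓘(ℝ, F) φ x) :
    ∃ η, IsVerticalField (F := F) φ η ∧ η x = v := by
  set e := trivializationAt E (TangentSpace 𝓘(ℝ, E) : M → Type _) x with he
  set D : E → E →L[ℝ] F := fderiv ℝ (writtenInExtChartAt 𝓘(ℝ, E) 𝓘(ℝ, F) x φ) with hD
  have hDs : ∀ y ∈ chartDomain (E := E) (F := F) φ x, ContDiffAt ℝ ∞ D (extChartAt 𝓘(ℝ, E) x y) :=
    fun y hy => (contDiffAt_writtenInExtChartAt hφ.contMDiff hy).fderiv_right (by norm_cast)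
  have hxb : x ∈ e.baseSet := FiberBundle.mem_baseSet_trivializationAt' x
  have hDx : Function.Surjective (D (extChartAt 𝓘(ℝ, E) x x)) :=
    fderiv_writtenInExtChartAt_surjective hφ x
  obtain ⟨R, hR⟩ := ContinuousLinearMap.exists_rightInverse_of_surjective
    (D (extChartAt 𝓘(ℝ, E) x x)) (LinearMap.range_eq_top.2 hDx)
  let w : E := e.continuousLinearMapAt ℝ x v
  let S : E → F →L[ℝ] F := fun z => (D z).comp R
  have hSs : ∀ y ∈ chartDomain (E := E) (F := F) φ x, ContDiffAt ℝ ∞ S (extChartAt 𝓘(ℝ, E) x y) :=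
    fun y hy => (hDs y hy).clm_comp contDiffAt_const
  let u : E → E := fun z => w - R ((S z).inverse (D z w))
  let U : Set M := chartDomain (E := E) (F := F) φ x ∩
    {y | (S (extChartAt 𝓘(ℝ, E) x y)).IsInvertible}
  have hU : IsOpen U := by
    refine ContinuousOn.isOpen_inter_preimage (f := fun y => S (extChartAt 𝓘(ℝ, E) x y))
      (t := {L | L.IsInvertible})
      (fun y hy => ?_) (isOpen_chartDomain hφ.contMDiff.continuous x) ?_
    · exact ((hSs y hy).continuousAt.comp
        (continuousAt_extChartAt' (by simpa using hy.1))).continuousWithinAt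
    · exact ContinuousLinearEquiv.isOpen
  have hSx : S (extChartAt 𝓘(ℝ, E) x x) = ContinuousLinearMap.id ℝ F := hR
  have hxU : x ∈ U := ⟨mem_chartDomain φ x, by
    rw [Set.mem_ofPred_eq, hSx]; exact ⟨ContinuousLinearEquiv.refl ℝ F, rfl⟩⟩
  have hus : ∀ y ∈ U, ContDiffAt ℝ ∞ u (extChartAt 𝓘(ℝ, E) x y) := fun y hy => by
    refine contDiffAt_const.sub (R.contDiff.contDiffAt.comp _ (ContDiffAt.clm_apply ?_ ?_))
    · exact hy.2.contDiffAt_map_inverse.comp _ (hSs y hy.1)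
    · exact (hDs y hy.1).clm_apply contDiffAt_const
  have huv : ∀ y ∈ U, e.symmL ℝ y (u (extChartAt 𝓘(ℝ, E) x y)) ∈
      verticalSpace 𝓘(ℝ, E) 𝓘(ℝ, F) φ y := fun y hy => by
    have hyb : y ∈ e.baseSet := by simpa [he] using hy.1.1
    rw [mem_verticalSpace_iff_fderiv hφ.contMDiff hy.1, e.continuousLinearMapAt_symmL hyb]
    obtain ⟨L, hL⟩ := hy.2
    have h4 : D (extChartAt 𝓘(ℝ, E) x y) (R ((S (extChartAt 𝓘(ℝ, E) x y)).inverse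
        (D (extChartAt 𝓘(ℝ, E) x y) w))) = D (extChartAt 𝓘(ℝ, E) x y) w := by
      change S (extChartAt 𝓘(ℝ, E) x y) _ = _
      rw [← hL, ContinuousLinearMap.inverse_equiv]
      exact L.apply_symm_apply _
    change D (extChartAt 𝓘(ℝ, E) x y) (w - _) = 0
    rw [map_sub, h4, sub_self]
  obtain ⟨η, h1, h2, h3⟩ := exists_contMDiff_section_of_local
    (fun y => verticalSpace 𝓘(ℝ, E) 𝓘(ℝ, F) φ y) hU hxU
    (contMDiffOn_symmL (fun y hy => hy.1.1) hus) huv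
  refine ⟨η, ⟨h1, h2⟩, h3.trans ?_⟩
  have h4 : D (extChartAt 𝓘(ℝ, E) x x) w = 0 :=
    (mem_verticalSpace_iff_fderiv hφ.contMDiff (mem_chartDomain φ x)).1 hv
  have h5 : u (extChartAt 𝓘(ℝ, E) x x) = w := by
    simp only [u, h4, map_zero, sub_zero]
  rw [h5]
  exact e.symmL_continuousLinearMapAt hxb v

end Extension

/-! ### Extending horizontal vectors to horizontal fields -/

section Horizontal

variable {E : Type*} [NormedAddCommGroup E] [NormedSpace ℝ E]
  {M : Type*} [TopologicalSpace M] [ChartedSpace E M] [IsManifold 𝓘(ℝ, E) ∞ M]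
  [RiemannianBundle (fun x : M => TangentSpace 𝓘(ℝ, E) x)]

/-- The Riemannian metric read in the chart at `x`, as a bilinear form on `E` depending on a
point `z` of the target of the chart (and of no meaning for other `z`). -/
def chartMetric (x : M) (z : E) : E →L[ℝ] E →L[ℝ] ℝ :=
  (innerSL ℝ (E := TangentSpace 𝓘(ℝ, E) ((extChartAt 𝓘(ℝ, E) x).symm z))).bilinearComp
    ((trivializationAt E (TangentSpace 𝓘(ℝ, E) : M → Type _) x).symmL ℝ
      ((extChartAt 𝓘(ℝ, E) x).symm z))
    ((trivializationAt E (TangentSpace 𝓘(ℝ, E) : M → Type _) x).symmL ℝ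
      ((extChartAt 𝓘(ℝ, E) x).symm z))

theorem chartMetric_extChartAt {x y : M} (hy : y ∈ (chartAt E x).source) (v w : E) :
    chartMetric x (extChartAt 𝓘(ℝ, E) x y) v w
      = inner ℝ ((trivializationAt E (TangentSpace 𝓘(ℝ, E) : M → Type _) x).symmL ℝ y v)
        ((trivializationAt E (TangentSpace 𝓘(ℝ, E) : M → Type _) x).symmL ℝ y w) := by
  have h : (extChartAt 𝓘(ℝ, E) x).symm (extChartAt 𝓘(ℝ, E) x y) = y :=
    (extChartAt 𝓘(ℝ, E) x).left_inv (by simpa using hy)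
  have h2 : ∀ y' : M, y' = y → inner ℝ
        ((trivializationAt E (TangentSpace 𝓘(ℝ, E) : M → Type _) x).symmL ℝ y' v)
        ((trivializationAt E (TangentSpace 𝓘(ℝ, E) : M → Type _) x).symmL ℝ y' w)
      = inner ℝ ((trivializationAt E (TangentSpace 𝓘(ℝ, E) : M → Type _) x).symmL ℝ y v)
        ((trivializationAt E (TangentSpace 𝓘(ℝ, E) : M → Type _) x).symmL ℝ y w) := by
    rintro _ rfl; rfl
  exact h2 _ h

variable {F : Type*} [NormedAddCommGroup F] [NormedSpace ℝ F]
  {N : Type*} [TopologicalSpace N] [ChartedSpace F N]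
  {φ : M → N}

theorem IsHorizontalField.smul {f : M → ℝ} (hf : ContMDiff 𝓘(ℝ, E) 𝓘(ℝ) ∞ f)
    {X : Π x : M, TangentSpace 𝓘(ℝ, E) x} (hX : IsHorizontalField (F := F) φ X) :
    IsHorizontalField (F := F) φ (f • X) :=
  ⟨hf.smul_section hX.contMDiff, fun x => Submodule.smul_mem _ _ (hX.horizontal x)⟩

variable [FiniteDimensional ℝ E]

theorem isInvertible_chartMetric {x y : M} (hy : y ∈ (chartAt E x).source) :
    (chartMetric x (extChartAt 𝓘(ℝ, E) x y)).IsInvertible := by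
  set B := chartMetric x (extChartAt 𝓘(ℝ, E) x y) with hB
  have hyb : y ∈ (trivializationAt E (TangentSpace 𝓘(ℝ, E) : M → Type _) x).baseSet := by
    simpa using hy
  have hinj : Function.Injective B.toLinearMap := by
    rw [injective_iff_map_eq_zero]
    intro v hv
    have h1 : B v v = 0 := congrArg (fun L : E →L[ℝ] ℝ => L v) hv
    rw [hB, chartMetric_extChartAt hy, inner_self_eq_zero] at h1
    have h2 := congrArg ((trivializationAt E (TangentSpace 𝓘(ℝ, E) : M → Type _)
      x).continuousLinearMapAt ℝ y) h1
    rwa [Trivialization.continuousLinearMapAt_symmL _ hyb, map_zero] at h2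
  have hfin : Module.finrank ℝ E = Module.finrank ℝ (E →L[ℝ] ℝ) := by
    rw [← (LinearMap.toContinuousLinearMap (𝕜 := ℝ) (E := E) (F' := ℝ)).finrank_eq]
    exact Subspace.dual_finrank_eq.symm
  exact ⟨(LinearMap.linearEquivOfInjective B.toLinearMap hinj hfin).toContinuousLinearEquiv, rfl⟩

variable [IsContMDiffRiemannianBundle 𝓘(ℝ, E) ∞ E (fun x : M => TangentSpace 𝓘(ℝ, E) x)]

theorem contDiffAt_chartMetric {x y : M} (hy : y ∈ (chartAt E x).source) :
    ContDiffAt ℝ ∞ (chartMetric x) (extChartAt 𝓘(ℝ, E) x y) := by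
  have hys : y ∈ (extChartAt 𝓘(ℝ, E) x).source := by simpa using hy
  suffices h : ContDiffOn ℝ ∞ (chartMetric x) (extChartAt 𝓘(ℝ, E) x).target from
    h.contDiffAt ((isOpen_extChartAt_target x).mem_nhds ((extChartAt 𝓘(ℝ, E) x).map_source hys))
  rw [contDiffOn_clm_apply]
  intro v
  rw [contDiffOn_clm_apply]
  intro w
  have hs : ∀ u : E, ContMDiffOn 𝓘(ℝ, E) 𝓘(ℝ, E).tangent ∞
      (fun y => (⟨y, (trivializationAt E (TangentSpace 𝓘(ℝ, E) : M → Type _) x).symmL ℝ y u⟩ :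
        TangentBundle 𝓘(ℝ, E) M)) (chartAt E x).source := fun u =>
    contMDiffOn_symmL subset_rfl fun y _ => contDiffAt_const (c := u)
  have h1 := ContMDiffOn.inner_bundle (IB := 𝓘(ℝ, E)) (F := E)
    (E := fun x : M => TangentSpace 𝓘(ℝ, E) x) (b := id) (hs v) (hs w)
  rw [← contMDiffOn_iff_contDiffOn]
  refine h1.comp (contMDiffOn_extChartAt_symm x) ?_
  intro z hz
  simpa using (extChartAt 𝓘(ℝ, E) x).map_target hz

variable [T2Space M] [FiniteDimensional ℝ F] [IsManifold 𝓘(ℝ, F) ∞ N]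

/-- A horizontal vector of a submersion extends to a horizontal field. In a chart, with `B` the
metric and `D` the derivative of `φ`, the field is `B⁻¹ (l ∘ D)`, the gradient of the function
`l ∘ φ` for a linear form `l` in a chart of the target. -/
theorem exists_isHorizontalField (hφ : IsSmoothSubmersion 𝓘(ℝ, E) 𝓘(ℝ, F) φ) {x : M}
    {v : TangentSpace 𝓘(ℝ, E) x} (hv : v ∈ (verticalSpace 𝓘(ℝ, E) 𝓘(ℝ, F) φ x)ᗮ) :
    ∃ X, IsHorizontalField (F := F) φ X ∧ X x = v := by
  set e := trivializationAt E (TangentSpace 𝓘(ℝ, E) : M → Type _) x with he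
  set D : E → E →L[ℝ] F := fderiv ℝ (writtenInExtChartAt 𝓘(ℝ, E) 𝓘(ℝ, F) x φ) with hD
  set U := chartDomain (E := E) (F := F) φ x with hU
  have hDs : ∀ y ∈ U, ContDiffAt ℝ ∞ D (extChartAt 𝓘(ℝ, E) x y) :=
    fun y hy => (contDiffAt_writtenInExtChartAt hφ.contMDiff hy).fderiv_right (by norm_cast)
  have hxb : x ∈ e.baseSet := FiberBundle.mem_baseSet_trivializationAt' x
  have hxs : x ∈ (chartAt E x).source := mem_chart_source E x
  obtain ⟨R, hR⟩ := ContinuousLinearMap.exists_rightInverse_of_surjective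
    (D (extChartAt 𝓘(ℝ, E) x x))
    (LinearMap.range_eq_top.2 (fderiv_writtenInExtChartAt_surjective hφ x))
  let w : E := e.continuousLinearMapAt ℝ x v
  have hw : e.symmL ℝ x w = v := e.symmL_continuousLinearMapAt hxb v
  let l : F →L[ℝ] ℝ := (chartMetric x (extChartAt 𝓘(ℝ, E) x x) w).comp R
  let u : E → E := fun z => (chartMetric x z).inverse (l.comp (D z))
  have hBu : ∀ y ∈ U, chartMetric x (extChartAt 𝓘(ℝ, E) x y) (u (extChartAt 𝓘(ℝ, E) x y))
      = l.comp (D (extChartAt 𝓘(ℝ, E) x y)) := fun y hy => by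
    obtain ⟨L, hL⟩ := isInvertible_chartMetric (M := M) (x := x) hy.1
    simp only [u]
    rw [← hL, ContinuousLinearMap.inverse_equiv]
    exact L.apply_symm_apply _
  have hus : ∀ y ∈ U, ContDiffAt ℝ ∞ u (extChartAt 𝓘(ℝ, E) x y) := fun y hy =>
    ContDiffAt.clm_apply ((isInvertible_chartMetric hy.1).contDiffAt_map_inverse.comp _
      (contDiffAt_chartMetric hy.1)) (contDiffAt_const.clm_comp (hDs y hy))
  have huh : ∀ y ∈ U, e.symmL ℝ y (u (extChartAt 𝓘(ℝ, E) x y)) ∈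
      (verticalSpace 𝓘(ℝ, E) 𝓘(ℝ, F) φ y)ᗮ := fun y hy => by
    have hyb : y ∈ e.baseSet := by simpa [he] using hy.1
    rw [Submodule.mem_orthogonal']
    intro a ha
    rw [mem_verticalSpace_iff_fderiv hφ.contMDiff hy] at ha
    rw [← e.symmL_continuousLinearMapAt (R := ℝ) hyb a, ← chartMetric_extChartAt hy.1, hBu y hy]
    exact (congrArg l ha).trans (map_zero l)
  obtain ⟨X, h1, h2, h3⟩ := exists_contMDiff_section_of_local
    (fun y => (verticalSpace 𝓘(ℝ, E) 𝓘(ℝ, F) φ y)ᗮ)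
    (isOpen_chartDomain hφ.contMDiff.continuous x) (mem_chartDomain φ x)
    (contMDiffOn_symmL (fun y hy => hy.1) hus) huh
  refine ⟨X, ⟨h1, h2⟩, h3.trans ?_⟩
  have h4 : u (extChartAt 𝓘(ℝ, E) x x) = w := by
    obtain ⟨L, hL⟩ := isInvertible_chartMetric (M := M) (x := x) hxs
    refine L.injective ?_
    have h5 : ∀ z, L z = chartMetric x (extChartAt 𝓘(ℝ, E) x x) z := fun z => by rw [← hL]; rfl
    rw [h5, h5, hBu x (mem_chartDomain φ x)]
    ext a
    -- `a - R (D a)` lies in the kernel of `D`, so it is orthogonal to `v`.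
    have h6 : chartMetric x (extChartAt 𝓘(ℝ, E) x x) w
        (a - R (D (extChartAt 𝓘(ℝ, E) x x) a)) = 0 := by
      rw [chartMetric_extChartAt hxs, hw]
      refine (Submodule.mem_orthogonal' _ _).1 hv _ ?_
      rw [mem_verticalSpace_iff_fderiv hφ.contMDiff (mem_chartDomain φ x),
        e.continuousLinearMapAt_symmL hxb]
      have h7 : D (extChartAt 𝓘(ℝ, E) x x) (R (D (extChartAt 𝓘(ℝ, E) x x) a))
          = D (extChartAt 𝓘(ℝ, E) x x) a :=
        congrArg (fun L : F →L[ℝ] F => L (D (extChartAt 𝓘(ℝ, E) x x) a)) hR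
      change D (extChartAt 𝓘(ℝ, E) x x) _ = 0
      rw [map_sub, h7, sub_self]
    rw [map_sub, sub_eq_zero] at h6
    exact h6.symm
  rw [h4]
  exact hw

end Horizontal

/-! ### The two spaces as spans -/

section Metric

variable {E : Type*} [NormedAddCommGroup E] [NormedSpace ℝ E] [FiniteDimensional ℝ E]
  {M : Type*} [TopologicalSpace M] [ChartedSpace E M] [IsManifold 𝓘(ℝ, E) ∞ M]
  [RiemannianBundle (fun x : M => TangentSpace 𝓘(ℝ, E) x)]
  [IsContMDiffRiemannianBundle 𝓘(ℝ, E) ∞ E (fun x : M => TangentSpace 𝓘(ℝ, E) x)]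

theorem leviCivita_smul_of_eq_zero {f : M → ℝ} {Y : Π x : M, TangentSpace 𝓘(ℝ, E) x} {x : M}
    (hf : MDifferentiableAt 𝓘(ℝ, E) 𝓘(ℝ) f x) (hY : MDiffAt (T% Y) x) (h0 : f x = 0)
    (v : TangentSpace 𝓘(ℝ, E) x) :
    leviCivita E M (f • Y) x v = mvfderiv 𝓘(ℝ, E) f x v • Y x := by
  rw [(leviCivita E M).isCovariantDerivativeOn.leibniz hY hf, h0, zero_smul, zero_add]
  rfl

omit [FiniteDimensional ℝ E] [IsManifold 𝓘(ℝ, E) ∞ M]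
  [IsContMDiffRiemannianBundle 𝓘(ℝ, E) ∞ E (fun x : M => TangentSpace 𝓘(ℝ, E) x)] in
theorem one_add_mul_inner_pos {a : ℝ} (ha : 0 ≤ a) (ξ : TangentBundle 𝓘(ℝ, E) M) :
    0 < 1 + a * inner ℝ ξ.snd ξ.snd :=
  add_pos_of_pos_of_nonneg one_pos (mul_nonneg ha real_inner_self_nonneg)

omit [FiniteDimensional ℝ E] [IsManifold 𝓘(ℝ, E) ∞ M]
  [IsContMDiffRiemannianBundle 𝓘(ℝ, E) ∞ E (fun x : M => TangentSpace 𝓘(ℝ, E) x)] in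
theorem omegaCG_rpow_pos {a : ℝ} (ha : 0 ≤ a) (p : ℝ) (ξ : TangentBundle 𝓘(ℝ, E) M) :
    0 < omegaCG a ξ ^ p :=
  Real.rpow_pos_of_pos (inv_pos.2 (one_add_mul_inner_pos ha ξ)) p

theorem cgMetric_apply (p q α : ℝ) (ξ : TangentBundle 𝓘(ℝ, E) M)
    (A B : TangentSpace 𝓘(ℝ, E).tangent ξ) :
    cgMetric p q α ξ A B = inner ℝ (projDeriv ξ A) (projDeriv ξ B)
      + omegaCG α ξ ^ p * (inner ℝ (connectionMap ξ A) (connectionMap ξ B)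
        + q * inner ℝ (connectionMap ξ A) ξ.snd * inner ℝ (connectionMap ξ B) ξ.snd) :=
  rfl

theorem cgMetric_comm (p q α : ℝ) (ξ : TangentBundle 𝓘(ℝ, E) M)
    (A B : TangentSpace 𝓘(ℝ, E).tangent ξ) : cgMetric p q α ξ A B = cgMetric p q α ξ B A := by
  rw [cgMetric_apply, cgMetric_apply, real_inner_comm, real_inner_comm (connectionMap ξ B)]
  ring

theorem eq_zero_of_cgMetric_self {p q α : ℝ} (hq : 0 ≤ q) (hα : 0 ≤ α)
    {ξ : TangentBundle 𝓘(ℝ, E) M} {A : TangentSpace 𝓘(ℝ, E).tangent ξ}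
    (h : cgMetric p q α ξ A A = 0) : A = 0 := by
  have hω := omegaCG_rpow_pos hα p ξ
  have h1 : 0 ≤ inner ℝ (projDeriv ξ A) (projDeriv ξ A) := real_inner_self_nonneg
  have h2 : 0 ≤ inner ℝ (connectionMap ξ A) (connectionMap ξ A) := real_inner_self_nonneg
  have h3 : 0 ≤ q * inner ℝ (connectionMap ξ A) ξ.snd * inner ℝ (connectionMap ξ A) ξ.snd := by
    rw [mul_assoc]
    exact mul_nonneg hq (mul_self_nonneg _)
  rw [cgMetric_apply] at h
  have h4 := (add_eq_zero_iff_of_nonneg h1 (mul_nonneg hω.le (add_nonneg h2 h3))).1 h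
  have h5 := (add_eq_zero_iff_of_nonneg h2 h3).1 ((mul_eq_zero.1 h4.2).resolve_left hω.ne')
  exact eq_zero_of_projDeriv_of_connectionMap (inner_self_eq_zero.1 h4.1)
    (inner_self_eq_zero.1 h5.1)

/-- The vector `X^v - q ω_q(ξ) ⟨X, ξ⟩ ξ^v + ω_α(ξ)^p (∇_ξ X)^h` of `T_ξ TM`, which is horizontal for
`φ_*` when the vector field `X` is horizontal. -/
def horizontalGenerator (p q α : ℝ) (ξ : TangentBundle 𝓘(ℝ, E) M)
    (X : Π x : M, TangentSpace 𝓘(ℝ, E) x) : TangentSpace 𝓘(ℝ, E).tangent ξ :=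
  verticalLift ξ (X ξ.proj)
    - (q * omegaCG q ξ * inner ℝ (X ξ.proj) ξ.snd) • verticalLift ξ ξ.snd
    + (omegaCG α ξ ^ p) • horizontalLift ξ (leviCivita E M X ξ.proj ξ.snd)

theorem projDeriv_horizontalGenerator (p q α : ℝ) (ξ : TangentBundle 𝓘(ℝ, E) M)
    (X : Π x : M, TangentSpace 𝓘(ℝ, E) x) :
    projDeriv ξ (horizontalGenerator p q α ξ X)
      = (omegaCG α ξ ^ p) • leviCivita E M X ξ.proj ξ.snd := by
  rw [horizontalGenerator, map_add, map_sub, map_smul, map_smul, projDeriv_verticalLift,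
    projDeriv_verticalLift, projDeriv_horizontalLift, smul_zero, sub_zero, zero_add]

theorem connectionMap_horizontalGenerator (p q α : ℝ) (ξ : TangentBundle 𝓘(ℝ, E) M)
    (X : Π x : M, TangentSpace 𝓘(ℝ, E) x) :
    connectionMap ξ (horizontalGenerator p q α ξ X)
      = X ξ.proj - (q * omegaCG q ξ * inner ℝ (X ξ.proj) ξ.snd) • ξ.snd := by
  rw [horizontalGenerator, map_add, map_sub, map_smul, map_smul, connectionMap_verticalLift,
    connectionMap_verticalLift, connectionMap_horizontalLift, smul_zero, add_zero]

variable {F : Type*} [NormedAddCommGroup F] [NormedSpace ℝ F]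
  {N : Type*} [TopologicalSpace N] [ChartedSpace F N] [IsManifold 𝓘(ℝ, F) ∞ N]
  {φ : M → N}

theorem isCompl_verticalSpaceTangent_horizontalSpaceTangent (φ : M → N) {p q α : ℝ} (hq : 0 ≤ q)
    (hα : 0 ≤ α) (ξ : TangentBundle 𝓘(ℝ, E) M) :
    IsCompl (verticalSpaceTangent (F := F) φ ξ)
      (horizontalSpaceTangent (F := F) p q α φ ξ) := by
  have : FiniteDimensional ℝ (TangentSpace 𝓘(ℝ, E).tangent ξ) :=
    inferInstanceAs (FiniteDimensional ℝ (E × E))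
  refine (LinearMap.BilinForm.isCompl_orthogonal_iff_disjoint (fun A B h => ?_)).2 ?_
  · rw [cgMetric_comm]; exact h
  · rw [Submodule.disjoint_def]
    exact fun A hA hA' => eq_zero_of_cgMetric_self hq hα (hA' A hA)

variable [T2Space M] [FiniteDimensional ℝ F]

/-- A vector `A` vertical for `φ_*` differs from the complete lift of a vertical field extending
`π_* A` by the vertical lift of a vertical vector `Z`, which is itself the complete lift of a vertical
field `f ζ` with `f = 0` and `∂_ξ f = 1` at the base point and `ζ` extending `Z`. -/
theorem verticalSpaceTangent_eq_span (hφ : IsSmoothSubmersion 𝓘(ℝ, E) 𝓘(ℝ, F) φ)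
    (ξ : TangentBundle 𝓘(ℝ, E) M) (hξ : ξ.snd ≠ 0) :
    verticalSpaceTangent (F := F) φ ξ
      = Submodule.span ℝ
        {A | ∃ η : Π x : M, TangentSpace 𝓘(ℝ, E) x, IsVerticalField (F := F) φ η ∧
          A = horizontalLift ξ (η ξ.proj)
            + verticalLift ξ (leviCivita E M η ξ.proj ξ.snd)} := by
  refine le_antisymm (fun A hA => ?_) (Submodule.span_le.2 ?_)
  · obtain ⟨η, hη, hηx⟩ := exists_isVerticalField hφ (projDeriv_mem_verticalSpace hφ.contMDiff hA)
    set C := horizontalLift ξ (η ξ.proj) + verticalLift ξ (leviCivita E M η ξ.proj ξ.snd) with hC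
    have hCV := completeLift_mem_verticalSpaceTangent hφ.contMDiff ξ hη
    have hp : projDeriv ξ (A - C) = 0 := by
      rw [map_sub, hC, map_add, projDeriv_horizontalLift, projDeriv_verticalLift, hηx, add_zero,
        sub_self]
    obtain ⟨ζ, hζ, hζx⟩ := exists_isVerticalField hφ
      (connectionMap_mem_verticalSpace hφ.contMDiff (Submodule.sub_mem _ hA hCV) hp)
    obtain ⟨f, hf, hfx, hfd⟩ := exists_contMDiff_eq_zero_mvfderiv_eq_one hξ
    have h1 : A - C = horizontalLift ξ ((f • ζ) ξ.proj)
        + verticalLift ξ (leviCivita E M (f • ζ) ξ.proj ξ.snd) := by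
      have h2 : (f • ζ) ξ.proj = 0 := by rw [Pi.smul_apply', hfx, zero_smul]
      rw [leviCivita_smul_of_eq_zero (hf.mdifferentiableAt (by simp))
        (hζ.contMDiff.mdifferentiableAt (by simp)) hfx, hfd, one_smul, hζx, h2]
      refine ext_projDeriv_connectionMap ?_ ?_
      · rw [hp, map_add, projDeriv_horizontalLift, projDeriv_verticalLift, add_zero]
      · rw [map_add (connectionMap ξ) (horizontalLift ξ 0), connectionMap_horizontalLift,
          connectionMap_verticalLift, zero_add]
    rw [← sub_add_cancel A C]
    exact Submodule.add_mem _ (Submodule.subset_span ⟨f • ζ, hζ.smul hf, h1⟩)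
      (Submodule.subset_span ⟨η, hη, rfl⟩)
  · rintro A ⟨η, hη, rfl⟩
    exact completeLift_mem_verticalSpaceTangent hφ.contMDiff ξ hη

/-- The coefficient `q ω_q(ξ) ⟨X, ξ⟩` is the one for which the vertical part `K A` of the generator
satisfies `⟨Z, K A⟩ + q ⟨Z, ξ⟩ ⟨K A, ξ⟩ = ⟨Z, X⟩` for all `Z`. -/
theorem horizontalGenerator_mem (hφ : IsSmoothSubmersion 𝓘(ℝ, E) 𝓘(ℝ, F) φ) (p : ℝ) {q : ℝ} (α : ℝ)
    (hq : 0 ≤ q) {ξ : TangentBundle 𝓘(ℝ, E) M} (hξ : ξ.snd ≠ 0)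
    {X : Π x : M, TangentSpace 𝓘(ℝ, E) x} (hX : IsHorizontalField (F := F) φ X) :
    horizontalGenerator p q α ξ X ∈ horizontalSpaceTangent (F := F) p q α φ ξ := by
  intro C hC
  rw [verticalSpaceTangent_eq_span hφ ξ hξ] at hC
  change cgMetric p q α ξ C (horizontalGenerator p q α ξ X) = 0
  induction hC using Submodule.span_induction with
  | zero => rw [map_zero, LinearMap.zero_apply]
  | add A B _ _ hA hB => rw [map_add, LinearMap.add_apply, hA, hB, add_zero]
  | smul c A _ hA => rw [map_smul, LinearMap.smul_apply, hA, smul_zero]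
  | mem A hA =>
    obtain ⟨η, hη, rfl⟩ := hA
    have hξd : MDiffAt (T% (constSection ξ)) ξ.proj := mdifferentiableAt_constSection ξ
    have hξx : constSection ξ ξ.proj = ξ.snd :=
      Trivialization.symm_apply_apply_mk _ (FiberBundle.mem_baseSet_trivializationAt' _) ξ.snd
    -- Differentiating `⟨η, X⟩ = 0` along `ξ` gives `⟨∇_ξ η, X⟩ + ⟨η, ∇_ξ X⟩ = 0`.
    have h0 : inner ℝ (leviCivita E M η ξ.proj ξ.snd) (X ξ.proj)
        + inner ℝ (η ξ.proj) (leviCivita E M X ξ.proj ξ.snd) = 0 := by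
      have h1 := leviCivita_metric hξd (hη.contMDiff.mdifferentiableAt (by simp))
        (hX.contMDiff.mdifferentiableAt (by simp))
      have h2 : (fun y => (inner ℝ (η y) (X y) : ℝ)) = fun _ => 0 := funext fun y =>
        (Submodule.mem_orthogonal _ _).1 (hX.horizontal y) _ (hη.vertical y)
      rw [h2, mvfderiv_const, hξx] at h1
      exact h1.symm
    rw [cgMetric_apply, projDeriv_horizontalGenerator, connectionMap_horizontalGenerator, map_add,
      map_add, projDeriv_horizontalLift, projDeriv_verticalLift, connectionMap_horizontalLift,
      connectionMap_verticalLift, add_zero, zero_add, inner_smul_right, inner_sub_right,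
      inner_sub_left, inner_smul_right, real_inner_smul_left]
    have h3 : omegaCG q ξ * (1 + q * inner ℝ ξ.snd ξ.snd) = 1 :=
      inv_mul_cancel₀ (one_add_mul_inner_pos hq ξ).ne'
    linear_combination omegaCG α ξ ^ p * h0
      - omegaCG α ξ ^ p * q * inner ℝ (leviCivita E M η ξ.proj ξ.snd) ξ.snd
        * inner ℝ (X ξ.proj) ξ.snd * h3

/-- Orthogonality of `B` to the vertical lifts of vertical vectors determines a horizontal field `X`
whose generator has the same image under `K` as `B`; the difference of the two is then the horizontal
lift of a horizontal vector, which is the generator of a field `f Y` with `f = 0` and `∂_ξ f = 1` at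
the base point. -/
theorem horizontalSpaceTangent_eq_span (hφ : IsSmoothSubmersion 𝓘(ℝ, E) 𝓘(ℝ, F) φ) {p q α : ℝ}
    (hq : 0 ≤ q) (hα : 0 ≤ α) (ξ : TangentBundle 𝓘(ℝ, E) M) (hξ : ξ.snd ≠ 0) :
    horizontalSpaceTangent (F := F) p q α φ ξ
      = Submodule.span ℝ
        {A | ∃ X : Π x : M, TangentSpace 𝓘(ℝ, E) x, IsHorizontalField (F := F) φ X ∧
          A = horizontalGenerator p q α ξ X} := by
  have hω := omegaCG_rpow_pos hα p ξ
  refine le_antisymm (fun B hB => ?_) (Submodule.span_le.2 ?_)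
  · have hVB : ∀ η, IsVerticalField (F := F) φ η → cgMetric p q α ξ (horizontalLift ξ (η ξ.proj)
        + verticalLift ξ (leviCivita E M η ξ.proj ξ.snd)) B = 0 := fun η hη =>
      hB _ (completeLift_mem_verticalSpaceTangent hφ.contMDiff ξ hη)
    obtain ⟨f, hf, hfx, hfd⟩ := exists_contMDiff_eq_zero_mvfderiv_eq_one hξ
    -- The vertical lifts of the vertical vectors `Z` are vertical, being given by the fields `f ζ`
    -- with `ζ` extending `Z`; hence the vector below is horizontal.
    have hv : connectionMap ξ B + (q * inner ℝ (connectionMap ξ B) ξ.snd) • ξ.snd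
        ∈ (verticalSpace 𝓘(ℝ, E) 𝓘(ℝ, F) φ ξ.proj)ᗮ := by
      rw [Submodule.mem_orthogonal]
      intro Z hZ
      obtain ⟨ζ, hζ, hζx⟩ := exists_isVerticalField hφ hZ
      have h1 := hVB _ (hζ.smul hf)
      rw [leviCivita_smul_of_eq_zero (hf.mdifferentiableAt (by simp))
        (hζ.contMDiff.mdifferentiableAt (by simp)) hfx, hfd, one_smul, hζx, Pi.smul_apply', hfx,
        zero_smul, cgMetric_apply, map_add, map_add, projDeriv_horizontalLift,
        projDeriv_verticalLift, connectionMap_horizontalLift, connectionMap_verticalLift, add_zero,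
        zero_add, inner_zero_left, zero_add] at h1
      have h2 := (mul_eq_zero.1 h1).resolve_left hω.ne'
      rw [inner_add_right, inner_smul_right]
      linear_combination h2
    obtain ⟨X, hX, hXx⟩ := exists_isHorizontalField hφ hv
    set C := horizontalGenerator p q α ξ X with hC
    have hCH : C ∈ horizontalSpaceTangent (F := F) p q α φ ξ :=
      horizontalGenerator_mem hφ p α hq hξ hX
    have hK : connectionMap ξ (B - C) = 0 := by
      have h3 : omegaCG q ξ * (1 + q * inner ℝ ξ.snd ξ.snd) = 1 :=
        inv_mul_cancel₀ (one_add_mul_inner_pos hq ξ).ne'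
      have h4 : q * omegaCG q ξ * inner ℝ (X ξ.proj) ξ.snd
          = q * inner ℝ (connectionMap ξ B) ξ.snd := by
        rw [hXx, inner_add_left, real_inner_smul_left]
        linear_combination q * inner ℝ (connectionMap ξ B) ξ.snd * h3
      rw [map_sub, hC, connectionMap_horizontalGenerator, h4, hXx, add_sub_cancel_right, sub_self]
    have hp : projDeriv ξ (B - C) ∈ (verticalSpace 𝓘(ℝ, E) 𝓘(ℝ, F) φ ξ.proj)ᗮ := by
      rw [Submodule.mem_orthogonal]
      intro Z hZ
      obtain ⟨ζ, hζ, hζx⟩ := exists_isVerticalField hφ hZ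
      have h1 : cgMetric p q α ξ _ (B - C) = 0 := (Submodule.sub_mem _ hB hCH) _
        (completeLift_mem_verticalSpaceTangent hφ.contMDiff ξ hζ)
      rw [cgMetric_apply, hK, map_add, projDeriv_horizontalLift, projDeriv_verticalLift, hζx,
        inner_zero_left, inner_zero_right, add_zero, mul_zero, add_zero, mul_zero, add_zero] at h1
      exact h1
    obtain ⟨Y, hY, hYx⟩ := exists_isHorizontalField hφ
      (Submodule.smul_mem _ (omegaCG α ξ ^ p)⁻¹ hp)
    have h1 : B - C = horizontalGenerator p q α ξ (f • Y) := by
      have h2 : (f • Y) ξ.proj = 0 := by rw [Pi.smul_apply', hfx, zero_smul]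
      refine ext_projDeriv_connectionMap ?_ ?_
      · rw [projDeriv_horizontalGenerator,
          leviCivita_smul_of_eq_zero (hf.mdifferentiableAt (by simp))
          (hY.contMDiff.mdifferentiableAt (by simp)) hfx, hfd, one_smul, hYx,
          smul_inv_smul₀ hω.ne']
      · rw [connectionMap_horizontalGenerator, h2, hK, inner_zero_left, mul_zero, zero_smul,
          sub_zero]
    rw [← sub_add_cancel B C]
    exact Submodule.add_mem _ (Submodule.subset_span ⟨f • Y, hY.smul hf, h1⟩)
      (Submodule.subset_span ⟨X, hX, rfl⟩)
  · rintro A ⟨X, hX, rfl⟩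
    exact horizontalGenerator_mem hφ p α hq hξ hX

end Metric

end CheegerGromoll

end

theorem theorem1p4
    {E : Type*} [NormedAddCommGroup E] [NormedSpace ℝ E] [FiniteDimensional ℝ E]
    {M : Type*} [TopologicalSpace M] [T2Space M] [SecondCountableTopology M]
    [ChartedSpace E M] [IsManifold 𝓘(ℝ, E) ∞ M]
    [RiemannianBundle (fun x : M => TangentSpace 𝓘(ℝ, E) x)]
    [IsContMDiffRiemannianBundle 𝓘(ℝ, E) ∞ E (fun x : M => TangentSpace 𝓘(ℝ, E) x)]
    {F : Type*} [NormedAddCommGroup F] [NormedSpace ℝ F] [FiniteDimensional ℝ F]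
    {N : Type*} [TopologicalSpace N] [T2Space N] [SecondCountableTopology N]
    [ChartedSpace F N] [IsManifold 𝓘(ℝ, F) ∞ N]
    (φ : M → N) (hφ : IsSmoothSubmersion 𝓘(ℝ, E) 𝓘(ℝ, F) φ)
    (p q α : ℝ) (hq : 0 ≤ q) (hα : 0 < α)
    (ξ : TangentBundle 𝓘(ℝ, E) M) :
    (∀ A ∈ verticalSpaceTangent (F := F) φ ξ, ∀ B ∈ horizontalSpaceTangent (F := F) p q α φ ξ,
      cgMetric p q α ξ A B = 0)
    ∧ IsCompl (verticalSpaceTangent (F := F) φ ξ) (horizontalSpaceTangent (F := F) p q α φ ξ)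
    ∧ (ξ.snd ≠ 0 →
      verticalSpaceTangent (F := F) φ ξ
        = Submodule.span ℝ
          {A | ∃ η : Π x : M, TangentSpace 𝓘(ℝ, E) x, IsVerticalField (F := F) φ η ∧
            A = horizontalLift ξ (η ξ.proj)
              + verticalLift ξ (leviCivita E M η ξ.proj ξ.snd)}
      ∧ horizontalSpaceTangent (F := F) p q α φ ξ
        = Submodule.span ℝ
          {A | ∃ X : Π x : M, TangentSpace 𝓘(ℝ, E) x, IsHorizontalField (F := F) φ X ∧
            A = verticalLift ξ (X ξ.proj)
              - (q * omegaCG q ξ * inner ℝ (X ξ.proj) ξ.snd) • verticalLift ξ ξ.snd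
              + (omegaCG α ξ ^ p) • horizontalLift ξ (leviCivita E M X ξ.proj ξ.snd)}) := by
  exact ⟨fun A hA B hB => hB A hA,
    isCompl_verticalSpaceTangent_horizontalSpaceTangent φ hq hα.le ξ,
    fun hξ => ⟨verticalSpaceTangent_eq_span hφ ξ hξ,
      horizontalSpaceTangent_eq_span hφ hq hα.le ξ hξ⟩⟩
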